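/- **Theorem (Mixed embeddings).** Let $n\ge 1$, let $\mathbb{R}^{1+n}_+=\{(t,x): t>0,\ x\in\mathbb{R}^n\}$, and let $F$ be a normed space; $L^0$ denotes the space of (a.e.-classes of) strongly measurable functions $f:\mathbb{R}^{1+n}_+\to F$. An *exponent* $\mathbf{p}$ is either a pair $(p,s)$ with $0<p<\infty$, $s\in\mathbb{R}$ (finite exponent), with $j(\mathbf{p})=1/p$ and $\theta(\mathbf{p})=s$, or a triple $(\infty,s;\alpha)$ with $s\in\mathbb{R}$, $\alpha\ge 0$ (infinite exponent), with $j(\mathbf{p})=-\alpha/n$ and $\theta(\mathbf{p})=s$. Write $\mathbf{p}\hookrightarrow\mathbf{q}$ if $\theta(\mathbf{p})-\theta(\mathbf{q})=n\,(j(\mathbf{p})-j(\mathbf{q}))$ and $\theta(\mathbf{q})\le\theta(\mathbf{p})$. The tent space $T^{\mathbf{p}}$ consists of all $f\in L^0$ with $\|f\|_{T^{\mathbf{p}}}<\infty$, where $$\|f\|_{T^{(p,s)}}=\Big(\int_{\mathbb{R}^n}\Big(\iint_{|y-x|<t}|t^{-s}f(t,y)|^2\,\frac{dy\,dt}{t^{n+1}}\Big)^{p/2}dx\Big)^{1/p},$$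 $$\|f\|_{T^{(\infty,s;\alpha)}}=\sup_{B}\ r_B^{-\alpha}\Big(\frac1{|B|}\iint_{T(B)}|t^{-s}f(t,y)|^2\,\frac{dy\,dt}{t}\Big)^{1/2},$$ the supremum being over all balls $B\subset\mathbb{R}^n$, with radius $r_B$ and tent $T(B)=\{(t,y)\in\mathbb{R}^{1+n}_+: B(y,t)\subset B\}$. For a Whitney parameter $c=(c_0,c_1)$ with $c_0>0$, $c_1>1$, put $$\mathcal{W}_cf(t,x)=\Big(\frac{1}{|\Omega_c(t,x)|}\iint_{\Omega_c(t,x)}|f|^2\Big)^{1/2},\qquad \Omega_c(t,x)=(c_1^{-1}t,c_1t)\times B(x,c_0t).$$ The space $Z^{\mathbf{p}}=Z^{\mathbf{p}}_c$ consists of all $f\in L^0$ with $\|f\|_{Z^{\mathbf{p}}_c}<\infty$, where $\|f\|_{Z^{(p,s)}_c}=\|\mathcal{W}_c(t^{-s}f)\|_{L^p(\mathbb{R}^{1+n}_+,\,dx\,dt/t)}$ and $\|f\|_{Z^{(\infty,s;\alpha)}_c}=\|\mathcal{W}_c(t^{-(s+\alpha)}f)\|_{L^\infty(\mathbb{R}^{1+n}_+)}$.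 Let $X_0,X_1\in\{T,Z\}$ and let $\mathbf{p}\hookrightarrow\mathbf{q}$ be exponents with $\mathbf{p}\ne\mathbf{q}$. Then $(X_0)^{\mathbf{p}}\hookrightarrow(X_1)^{\mathbf{q}}$: one has $(X_0)^{\mathbf{p}}\subset(X_1)^{\mathbf{q}}$, and there is a constant $C<\infty$ such that $$\|f\|_{(X_1)^{\mathbf{q}}}\le C\,\|f\|_{(X_0)^{\mathbf{p}}}\qquad\text{for all } f\in(X_0)^{\mathbf{p}}.$$ This holds for every choice of Whitney parameters $c$ and $d$ in the definitions of the $Z$-spaces on the left and on the right, respectively (with $C$ allowed to depend on them). -/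

import Mathlib

open MeasureTheory
open scoped ENNReal NNReal

namespace FractionalData

noncomputable section

/-- Exponents: finite exponents `(p, s)` with `0 < p < ∞` and `s ∈ ℝ`, and infinite exponents
`(∞, s; α)` with `s ∈ ℝ` and `α ≥ 0`. -/
inductive Exponent : Type
  | finite (p s : ℝ) (hp : 0 < p) : Exponent
  | infinite (s α : ℝ) (hα : 0 ≤ α) : Exponent

namespace Exponent

/-- Integrability `i(𝐩) ∈ (0, ∞]`. -/
def i : Exponent → ℝ≥0∞
  | finite p _ _ => ENNReal.ofReal p
  | infinite _ _ _ => ∞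

/-- The coordinate `j(𝐩)`: it is `1 / p` for `(p, s)` and `-α / n` for `(∞, s; α)`. -/
def j (n : ℕ) : Exponent → ℝ
  | finite p _ _ => 1 / p
  | infinite _ α _ => -α / n

/-- The coordinate `θ(𝐩) = s`. -/
def θ : Exponent → ℝ
  | finite _ s _ => s
  | infinite s _ _ => s

/-- The regularity that enters the `Z`-space norm: `s` for `(p, s)` and `s + α` for
`(∞, s; α)`. -/
def reg : Exponent → ℝ
  | finite _ s _ => s
  | infinite s α _ => s + α

/-- The relation `𝐩 ↪ 𝐪` between exponents. -/
def Embeds (n : ℕ) (p q : Exponent) : Prop :=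
  p.θ - q.θ = n * (p.j n - q.j n) ∧ q.θ ≤ p.θ

end Exponent

/-- `ℝ × ℝⁿ`, with the Euclidean norm on `ℝⁿ`; points are written `(t, x)`. -/
abbrev Space (n : ℕ) : Type := ℝ × EuclideanSpace ℝ (Fin n)

/-- The open upper half-space `{(t, x) : t > 0}`. -/
def upperHalf (n : ℕ) : Set (Space n) := {z | 0 < z.1}

/-- `L⁰`: a.e.-classes of strongly measurable `F`-valued functions on the upper half-space, with
respect to Lebesgue measure. -/
abbrev L0 (n : ℕ) (F : Type*) [NormedAddCommGroup F] : Type _ :=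
  Space n →ₘ[(volume : Measure (Space n)).restrict (upperHalf n)] F

/-- The measure `dx dt / t` on the upper half-space. -/
def haarUpper (n : ℕ) : Measure (Space n) :=
  ((volume : Measure (Space n)).restrict (upperHalf n)).withDensity
    fun z => ENNReal.ofReal (1 / z.1)

section Norms

variable {n : ℕ} {F : Type*} [NormedAddCommGroup F]

/-- Multiplication by a power of `t`: `(κ^σ f)(t, x) = t^σ f(t, x)`. -/
def kappa [NormedSpace ℝ F] (σ : ℝ) (f : Space n → F) : Space n → F :=
  fun z => (z.1 ^ σ) • f z

/-- The cone `Γ(x) = {(t, y) : t > 0, |y - x| < t}`. -/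
def cone (x : EuclideanSpace ℝ (Fin n)) : Set (Space n) :=
  {z | 0 < z.1 ∧ dist z.2 x < z.1}

/-- The tent `T(B)` over the ball `B = B(x, r)`, that is, the set of all `(t, y)` with `t > 0` and
`B(y, t) ⊆ B(x, r)`. -/
def tent (x : EuclideanSpace ℝ (Fin n)) (r : ℝ) : Set (Space n) :=
  {z | 0 < z.1 ∧ dist z.2 x + z.1 ≤ r}

/-- The conical square function
`𝓐f(x) = (∬_{Γ(x)} |f(t, y)|² dy dt / t^{n+1})^{1/2}`. -/
def conical (f : Space n → F) (x : EuclideanSpace ℝ (Fin n)) : ℝ≥0∞ :=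
  (∫⁻ z in cone x, ‖f z‖ₑ ^ 2 * ENNReal.ofReal (1 / z.1 ^ (n + 1))) ^ (1 / 2 : ℝ)

/-- The weighted Carleson norm
`sup_B r_B^{-α} (|B|⁻¹ ∬_{T(B)} |f(t, y)|² dy dt / t)^{1/2}`, the supremum being over all balls. -/
def carleson (α : ℝ) (f : Space n → F) : ℝ≥0∞ :=
  ⨆ (x : EuclideanSpace ℝ (Fin n)) (r : ℝ) (_ : 0 < r),
    ENNReal.ofReal (r ^ (-α)) *
      ((volume (Metric.ball x r))⁻¹ *
        ∫⁻ z in tent x r, ‖f z‖ₑ ^ 2 * ENNReal.ofReal (1 / z.1)) ^ (1 / 2 : ℝ)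

/-- Whitney parameters `c = (c₀, c₁)` with `c₀ > 0` and `c₁ > 1`. -/
structure Whitney : Type where
  c₀ : ℝ
  c₁ : ℝ
  c₀_pos : 0 < c₀
  one_lt_c₁ : 1 < c₁

/-- The Whitney region `Ω_c(t, x) = (c₁⁻¹ t, c₁ t) × B(x, c₀ t)`. -/
def Whitney.region (c : Whitney) (z : Space n) : Set (Space n) :=
  Set.Ioo (c.c₁⁻¹ * z.1) (c.c₁ * z.1) ×ˢ Metric.ball z.2 (c.c₀ * z.1)

/-- The Whitney average `𝓦_c f(t, x) = (⨍_{Ω_c(t, x)} |f|²)^{1/2}` (Lebesgue average). -/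
def Whitney.average (c : Whitney) (f : Space n → F) (z : Space n) : ℝ≥0∞ :=
  (⨍⁻ w in c.region z, ‖f w‖ₑ ^ 2 ∂volume) ^ (1 / 2 : ℝ)

variable [NormedSpace ℝ F]

/-- The tent space quasi-norm: `‖𝓐(t^{-s} f)‖_{L^p(ℝⁿ)}` for the exponent `(p, s)`, and the
weighted Carleson norm of `t^{-s} f` for the exponent `(∞, s; α)`. -/
def tentNorm (f : Space n → F) : Exponent → ℝ≥0∞
  | .finite p s _ => eLpNorm (conical (kappa (-s) f)) (ENNReal.ofReal p) volume
  | .infinite s α _ => carleson α (kappa (-s) f)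

/-- The `Z`-space quasi-norm: `‖𝓦_c(t^{-s} f)‖_{L^p(dx dt / t)}` for the exponent `(p, s)`, and
`‖𝓦_c(t^{-(s + α)} f)‖_{L^∞}` for the exponent `(∞, s; α)`. -/
def zNorm (c : Whitney) (f : Space n → F) (p : Exponent) : ℝ≥0∞ :=
  eLpNorm (c.average (kappa (-p.reg) f)) p.i (haarUpper n)

end Norms

/-- The two scales of function spaces. -/
inductive Scale : Type
  | T : Scale
  | Z : Scale

/-- The quasi-norm of `X^𝐩` for `X ∈ {T, Z}`; the Whitney parameter `c` is used for `X = Z`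
only. -/
def Scale.qnorm {n : ℕ} {F : Type*} [NormedAddCommGroup F] [NormedSpace ℝ F]
    (X : Scale) (c : Whitney) (p : Exponent) (f : L0 n F) : ℝ≥0∞ :=
  match X with
  | .T => tentNorm f p
  | .Z => zNorm c f p

/-- The space `X^𝐩`: all `f ∈ L⁰` with finite quasi-norm. -/
def Scale.space (n : ℕ) (F : Type*) [NormedAddCommGroup F] [NormedSpace ℝ F]
    (X : Scale) (c : Whitney) (p : Exponent) : Set (L0 n F) :=
  {f | X.qnorm c p f < ∞}

end

end FractionalData

/-!
For a finite exponent everything passes through the Kenig–Pipher quasi-norm, the `L^p(ℝⁿ)`-norm of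
the nontangential maximal function `N` of the Whitney averages `u` of `t^{-s} f`; both source norms
dominate it. On the vertical line over `x` one has `u(t, x) ≤ N(x)`, and averaging `N` over a
ball of radius comparable to `t` gives `u(t, x) ≲ t^{-n/p} ‖N‖_p`. The first bound makes the
integral over `t` of a power of `t^{n/p - n/q} u` converge at `0`, the second at `∞`; splitting at
the height where they agree bounds it by a power of `N(x)^{p/q} ‖N‖_p^{1 - p/q}`, whose `L^q`-norm
in `x` is `‖N‖_p`, as in Hedberg's proof of the Hardy–Littlewood–Sobolev inequality. Between
infinite exponents, pointwise bounds on the averages suffice, since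
`t^{2α}` is integrable at `0` with respect to `dt / t` for `α > 0`.
-/

namespace FractionalData

open Set Metric Filter

noncomputable section

section Weight

/-- The power weight `t ↦ t ^ a` with values in `[0, ∞]`. -/
def weight (a t : ℝ) : ℝ≥0∞ := ENNReal.ofReal t ^ a

variable {a b c t t' : ℝ}

lemma weight_eq_ofReal (a : ℝ) (ht : 0 < t) : weight a t = ENNReal.ofReal (t ^ a) :=
  ENNReal.ofReal_rpow_of_pos ht

lemma weight_ne_zero (a : ℝ) (ht : 0 < t) : weight a t ≠ 0 := by
  rw [weight_eq_ofReal a ht]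
  exact (ENNReal.ofReal_pos.2 (Real.rpow_pos_of_pos ht a)).ne'

lemma weight_ne_top (a : ℝ) (ht : 0 < t) : weight a t ≠ ∞ := by
  rw [weight_eq_ofReal a ht]
  exact ENNReal.ofReal_ne_top

@[simp] lemma weight_zero (t : ℝ) : weight 0 t = 1 := ENNReal.rpow_zero

lemma weight_mul_weight (ht : 0 < t) (h : a + b = c) : weight a t * weight b t = weight c t := by
  rw [← h]
  exact (ENNReal.rpow_add a b (ENNReal.ofReal_pos.2 ht).ne' ENNReal.ofReal_ne_top).symm

lemma weight_neg_mul_self (a : ℝ) (ht : 0 < t) : weight (-a) t * weight a t = 1 := by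
  rw [weight_mul_weight ht (neg_add_cancel a), weight_zero]

lemma weight_rpow (a r t : ℝ) : weight a t ^ r = weight (a * r) t :=
  (ENNReal.rpow_mul _ _ _).symm

lemma weight_sq (a t : ℝ) : weight a t ^ 2 = weight (2 * a) t := by
  rw [← ENNReal.rpow_two, weight_rpow, mul_comm]

lemma inv_weight (a t : ℝ) : (weight a t)⁻¹ = weight (-a) t := (ENNReal.rpow_neg _ a).symm

lemma weight_mul (a : ℝ) (ht : 0 < t) (t' : ℝ) : weight a (t * t') = weight a t * weight a t' := by
  rw [weight, ENNReal.ofReal_mul ht.le,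
    ENNReal.mul_rpow_of_ne_top ENNReal.ofReal_ne_top ENNReal.ofReal_ne_top, weight, weight]

lemma measurable_weight (a : ℝ) : Measurable (weight a) := by
  unfold weight
  fun_prop

lemma weight_mono (ha : 0 ≤ a) : Monotone (weight a) := fun _ _ h =>
  ENNReal.rpow_le_rpow (ENNReal.ofReal_le_ofReal h) ha

lemma weight_anti (ha : a ≤ 0) : Antitone (weight a) := fun t t' h => by
  rw [← neg_neg a, ← inv_weight _ t, ← inv_weight _ t']
  exact ENNReal.inv_le_inv.2 (weight_mono (neg_nonneg.2 ha) h)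

lemma weight_le_weight_abs_mul (a : ℝ) {l : ℝ} (hl : 0 < l) (h₁ : t ≤ l * t') (h₂ : t' ≤ l * t) :
    weight a t ≤ weight |a| l * weight a t' := by
  rcases le_total 0 a with ha | ha
  · rw [abs_of_nonneg ha, ← weight_mul a hl]
    exact weight_mono ha h₁
  · calc weight a t = weight (-a) l * weight a l * weight a t := by
          rw [weight_neg_mul_self a hl, one_mul]
      _ = weight |a| l * weight a (l * t) := by rw [abs_of_nonpos ha, weight_mul a hl, mul_assoc]
      _ ≤ weight |a| l * weight a t' := by gcongr; exact weight_anti ha h₂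

end Weight

section HaarIoi

/-- The multiplicative Haar measure `dt / t` on the half-line `(0, ∞)`. -/
def haarIoi : Measure ℝ := (volume.restrict (Ioi 0)).withDensity (weight (-1))

instance : SFinite haarIoi := by
  unfold haarIoi
  infer_instance

lemma ae_haarIoi_pos : ∀ᵐ t ∂haarIoi, 0 < t :=
  (withDensity_absolutelyContinuous _ _).ae_le (ae_restrict_mem measurableSet_Ioi)

lemma restrict_haarIoi : haarIoi.restrict (Ioi 0) = haarIoi :=
  Measure.restrict_eq_self_of_ae_mem ae_haarIoi_pos

lemma setLIntegral_haarIoi {s : Set ℝ} (hs : MeasurableSet s) (hpos : s ⊆ Ioi 0) (φ : ℝ → ℝ≥0∞) :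
    ∫⁻ t in s, φ t ∂haarIoi = ∫⁻ t in s, weight (-1) t * φ t := by
  have hfin : ∀ᵐ t ∂(volume.restrict (Ioi (0 : ℝ))).restrict s, weight (-1) t < ∞ := by
    filter_upwards [ae_restrict_mem hs] with t ht using (weight_ne_top _ (hpos ht)).lt_top
  rw [haarIoi, restrict_withDensity hs,
    lintegral_withDensity_eq_lintegral_mul_non_measurable _ (measurable_weight _) hfin,
    Measure.restrict_restrict_of_subset hpos]
  rfl

lemma setLIntegral_haarIoi_weight (e : ℝ) {s : Set ℝ} (hs : MeasurableSet s) (hpos : s ⊆ Ioi 0)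
    (hint : IntegrableOn (fun t : ℝ => t ^ (e - 1)) s) :
    ∫⁻ t in s, weight e t ∂haarIoi = ENNReal.ofReal (∫ t in s, t ^ (e - 1)) := by
  rw [setLIntegral_haarIoi hs hpos, ofReal_integral_eq_lintegral_ofReal hint]
  · refine setLIntegral_congr_fun hs fun t ht => ?_
    rw [weight_mul_weight (hpos ht) (by ring : -1 + e = e - 1), weight_eq_ofReal _ (hpos ht)]
  · filter_upwards [ae_restrict_mem hs] with t ht using Real.rpow_nonneg (le_of_lt (hpos ht)) _

lemma setLIntegral_Ioc_weight {a T : ℝ} (ha : 0 < a) (hT : 0 < T) :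
    ∫⁻ t in Ioc 0 T, weight a t ∂haarIoi = ENNReal.ofReal a⁻¹ * weight a T := by
  have hint : IntervalIntegrable (fun t : ℝ => t ^ (a - 1)) volume 0 T :=
    intervalIntegral.intervalIntegrable_rpow' (by linarith)
  rw [setLIntegral_haarIoi_weight a measurableSet_Ioc (fun _ h => h.1)
      ((intervalIntegrable_iff_integrableOn_Ioc_of_le hT.le).1 hint),
    ← intervalIntegral.integral_of_le hT.le, integral_rpow (Or.inl (by linarith)),
    weight_eq_ofReal _ hT, ← ENNReal.ofReal_mul (by positivity), sub_add_cancel,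
    Real.zero_rpow ha.ne', sub_zero, div_eq_inv_mul]

lemma setLIntegral_Ioi_weight_neg {b T : ℝ} (hb : 0 < b) (hT : 0 < T) :
    ∫⁻ t in Ioi T, weight (-b) t ∂haarIoi = ENNReal.ofReal b⁻¹ * weight (-b) T := by
  rw [setLIntegral_haarIoi_weight _ measurableSet_Ioi (fun _ h => hT.trans h)
      (integrableOn_Ioi_rpow_of_lt (by linarith) hT),
    integral_Ioi_rpow_of_lt (by linarith) hT, weight_eq_ofReal _ hT,
    ← ENNReal.ofReal_mul (by positivity), sub_add_cancel, neg_div_neg_eq, div_eq_inv_mul]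

variable {a b r T : ℝ} {u : ℝ → ℝ≥0∞} {S M : ℝ≥0∞}

lemma setLIntegral_Ioc_rpow_le (ha : 0 < a) (hr : 0 < r) (hT : 0 < T)
    (hu : ∀ t, 0 < t → u t ≤ weight a t * S) :
    ∫⁻ t in Ioc 0 T, u t ^ r ∂haarIoi ≤ ENNReal.ofReal (a * r)⁻¹ * (weight a T * S) ^ r := by
  calc ∫⁻ t in Ioc 0 T, u t ^ r ∂haarIoi
      ≤ ∫⁻ t in Ioc 0 T, weight (a * r) t * S ^ r ∂haarIoi := by
        refine setLIntegral_mono' measurableSet_Ioc fun t ht => ?_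
        rw [← weight_rpow, ← ENNReal.mul_rpow_of_nonneg _ _ hr.le]
        gcongr
        exact hu t ht.1
    _ = ENNReal.ofReal (a * r)⁻¹ * (weight a T * S) ^ r := by
        rw [lintegral_mul_const _ (measurable_weight _),
          setLIntegral_Ioc_weight (mul_pos ha hr) hT, ENNReal.mul_rpow_of_nonneg _ _ hr.le,
          weight_rpow, mul_assoc]

lemma setLIntegral_Ioi_rpow_le (hb : 0 < b) (hr : 0 < r) (hT : 0 < T)
    (hu : ∀ t, 0 < t → u t ≤ weight (-b) t * M) :
    ∫⁻ t in Ioi T, u t ^ r ∂haarIoi ≤ ENNReal.ofReal (b * r)⁻¹ * (weight (-b) T * M) ^ r := by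
  calc ∫⁻ t in Ioi T, u t ^ r ∂haarIoi
      ≤ ∫⁻ t in Ioi T, weight (-(b * r)) t * M ^ r ∂haarIoi := by
        refine setLIntegral_mono' measurableSet_Ioi fun t ht => ?_
        rw [← neg_mul, ← weight_rpow, ← ENNReal.mul_rpow_of_nonneg _ _ hr.le]
        gcongr
        exact hu t (hT.trans ht)
    _ = ENNReal.ofReal (b * r)⁻¹ * (weight (-b) T * M) ^ r := by
        rw [lintegral_mul_const _ (measurable_weight _),
          setLIntegral_Ioi_weight_neg (mul_pos hb hr) hT, ENNReal.mul_rpow_of_nonneg _ _ hr.le,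
          weight_rpow, neg_mul, mul_assoc]

lemma exists_balanced_height (ha : 0 < a) (hb : 0 < b) (hS₀ : S ≠ 0) (hS : S ≠ ∞) (hM₀ : M ≠ 0)
    (hM : M ≠ ∞) :
    ∃ T : ℝ, 0 < T ∧ weight a T * S = S ^ (b / (a + b)) * M ^ (a / (a + b)) ∧
      weight (-b) T * M = S ^ (b / (a + b)) * M ^ (a / (a + b)) := by
  have hab : 0 < a + b := add_pos ha hb
  have hT_top : (M / S) ^ (a + b)⁻¹ ≠ ∞ :=
    ENNReal.rpow_ne_top_of_nonneg (inv_pos.2 hab).le (ENNReal.div_ne_top hM hS₀)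
  have hT_pos : 0 < (M / S) ^ (a + b)⁻¹ :=
    ENNReal.rpow_pos (ENNReal.div_pos hM₀ hS) (ENNReal.div_ne_top hM hS₀)
  have hweight (e : ℝ) : weight e ((M / S) ^ (a + b)⁻¹).toReal
      = M ^ (e / (a + b)) * S ^ (-(e / (a + b))) := by
    rw [weight, ENNReal.ofReal_toReal hT_top, ← ENNReal.rpow_mul, inv_mul_eq_div, div_eq_mul_inv M,
      ENNReal.mul_rpow_of_ne_top hM (ENNReal.inv_ne_top.2 hS₀), ENNReal.inv_rpow, ENNReal.rpow_neg]
  have hadd_one {x : ℝ≥0∞} (hx₀ : x ≠ 0) (hx : x ≠ ∞) (e : ℝ) : x ^ e * x = x ^ (e + 1) := by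
    rw [ENNReal.rpow_add _ _ hx₀ hx, ENNReal.rpow_one]
  refine ⟨_, ENNReal.toReal_pos hT_pos.ne' hT_top, ?_, ?_⟩
  · rw [hweight, mul_assoc, hadd_one hS₀ hS, mul_comm]
    congr 2
    field_simp
    ring
  · rw [hweight, mul_right_comm, hadd_one hM₀ hM, mul_comm]
    congr 2
    · field_simp
    · field_simp
      ring

theorem exists_lintegral_rpow_le_of_le_weight (ha : 0 < a) (hb : 0 < b) (hr : 0 < r) :
    ∃ C : ℝ≥0∞, C ≠ ∞ ∧ ∀ (u : ℝ → ℝ≥0∞) (S M : ℝ≥0∞),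
      (∀ t, 0 < t → u t ≤ weight a t * S) → (∀ t, 0 < t → u t ≤ weight (-b) t * M) →
        ∫⁻ t, u t ^ r ∂haarIoi ≤ C * (S ^ (b / (a + b)) * M ^ (a / (a + b))) ^ r := by
  have hb' : 0 < b / (a + b) := by positivity
  have ha' : 0 < a / (a + b) := by positivity
  have hC : ENNReal.ofReal (a * r)⁻¹ + ENNReal.ofReal (b * r)⁻¹ ≠ 0 :=
    add_ne_zero.2 (Or.inl (ENNReal.ofReal_pos.2 (inv_pos.2 (mul_pos ha hr))).ne')
  refine ⟨ENNReal.ofReal (a * r)⁻¹ + ENNReal.ofReal (b * r)⁻¹, by finiteness,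
    fun u S M huS huM => ?_⟩
  by_cases hzero : S = 0 ∨ M = 0
  · have hu : ∀ᵐ t ∂haarIoi, u t ^ r = 0 := by
      filter_upwards [ae_haarIoi_pos] with t ht
      have : u t = 0 := by
        rcases hzero with rfl | rfl
        · simpa using huS t ht
        · simpa using huM t ht
      simp [this, hr]
    simp [lintegral_congr_ae hu]
  obtain ⟨hS₀, hM₀⟩ := not_or.1 hzero
  by_cases htop : S = ∞ ∨ M = ∞
  · have : S ^ (b / (a + b)) * M ^ (a / (a + b)) = ∞ := by
      rw [ENNReal.mul_eq_top]
      rcases htop with rfl | rfl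
      · exact Or.inr ⟨ENNReal.top_rpow_of_pos hb', by simp [hM₀, ha'.le]⟩
      · exact Or.inl ⟨by simp [hS₀, hb'.le], ENNReal.top_rpow_of_pos ha'⟩
    rw [this, ENNReal.top_rpow_of_pos hr, ENNReal.mul_top hC]
    exact le_top
  obtain ⟨hS, hM⟩ := not_or.1 htop
  obtain ⟨T, hT, hTS, hTM⟩ := exists_balanced_height ha hb hS₀ hS hM₀ hM
  calc ∫⁻ t, u t ^ r ∂haarIoi
      = ∫⁻ t in Ioc 0 T ∪ Ioi T, u t ^ r ∂haarIoi := by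
        rw [Ioc_union_Ioi_eq_Ioi hT.le, restrict_haarIoi]
    _ ≤ ∫⁻ t in Ioc 0 T, u t ^ r ∂haarIoi + ∫⁻ t in Ioi T, u t ^ r ∂haarIoi :=
        lintegral_union_le _ _ _
    _ ≤ ENNReal.ofReal (a * r)⁻¹ * (weight a T * S) ^ r
        + ENNReal.ofReal (b * r)⁻¹ * (weight (-b) T * M) ^ r :=
        add_le_add (setLIntegral_Ioc_rpow_le ha hr hT huS) (setLIntegral_Ioi_rpow_le hb hr hT huM)
    _ = _ := by rw [hTS, hTM, add_mul]

end HaarIoi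

section HaarUpper

variable {n : ℕ}

lemma haarUpper_eq_prod (n : ℕ) : haarUpper n = haarIoi.prod volume := by
  have hhalf : upperHalf n = Ioi (0 : ℝ) ×ˢ univ := by
    ext z
    simp [upperHalf]
  rw [haarIoi, prod_withDensity_left (measurable_weight _), haarUpper, hhalf,
    Measure.volume_eq_prod, ← Measure.prod_restrict, Measure.restrict_univ]
  refine withDensity_congr_ae ?_
  filter_upwards [Measure.quasiMeasurePreserving_fst.ae (ae_restrict_mem measurableSet_Ioi)]
    with z hz
  rw [weight_eq_ofReal _ hz, Real.rpow_neg_one, one_div]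

instance : SFinite (haarUpper n) := by
  rw [haarUpper_eq_prod]
  infer_instance

lemma measurableSet_upperHalf : MeasurableSet (upperHalf n) :=
  measurableSet_lt measurable_const measurable_fst

lemma ae_haarUpper_pos : ∀ᵐ z ∂haarUpper n, 0 < z.1 :=
  (withDensity_absolutelyContinuous _ _).ae_le (ae_restrict_mem measurableSet_upperHalf)

lemma setLIntegral_haarUpper {s : Set (Space n)} (hs : MeasurableSet s) (hpos : s ⊆ upperHalf n)
    (φ : Space n → ℝ≥0∞) :
    ∫⁻ z in s, φ z ∂haarUpper n = ∫⁻ z in s, φ z * ENNReal.ofReal (1 / z.1) := by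
  rw [haarUpper, restrict_withDensity hs,
    lintegral_withDensity_eq_lintegral_mul_non_measurable _ (by fun_prop)
      (Eventually.of_forall fun _ => ENNReal.ofReal_lt_top),
    Measure.restrict_restrict_of_subset hpos]
  simp only [Pi.mul_apply, mul_comm]

lemma haarUpper_ne_zero {s : Set (Space n)} (hpos : s ⊆ upperHalf n) (hs : volume s ≠ 0) :
    haarUpper n s ≠ 0 := by
  have hac : (volume : Measure (Space n)).restrict (upperHalf n) ≪ haarUpper n := by
    refine withDensity_absolutelyContinuous' (by fun_prop) ?_
    filter_upwards [ae_restrict_mem measurableSet_upperHalf] with z hz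
    exact (ENNReal.ofReal_pos.2 (one_div_pos.2 hz)).ne'
  refine fun h => hs ?_
  rw [← Measure.restrict_eq_self _ hpos]
  exact hac h

end HaarUpper

section Fiber

variable {α β : Type*} [MeasurableSpace α] [MeasurableSpace β] (ν : Measure β) [SFinite ν]
  {R : Set (α × β)}

lemma measurable_setLIntegral_fiber (hR : MeasurableSet R) {G : α × β → ℝ≥0∞} (hG : Measurable G) :
    Measurable fun a => ∫⁻ b in {b | (a, b) ∈ R}, G (a, b) ∂ν := by
  have h (a : α) : ∫⁻ b in {b | (a, b) ∈ R}, G (a, b) ∂ν = ∫⁻ b, R.indicator G (a, b) ∂ν :=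
    (lintegral_indicator (measurable_prodMk_left hR) _).symm
  simp only [h]
  exact (hG.indicator hR).lintegral_prod_right'

lemma lintegral_setLIntegral_fiber_swap (μ : Measure α) [SFinite μ] (hR : MeasurableSet R)
    {G : α × β → ℝ≥0∞} (hG : Measurable G) :
    ∫⁻ a, ∫⁻ b in {b | (a, b) ∈ R}, G (a, b) ∂ν ∂μ
      = ∫⁻ b, ∫⁻ a in {a | (a, b) ∈ R}, G (a, b) ∂μ ∂ν := by
  have hleft (a : α) : ∫⁻ b in {b | (a, b) ∈ R}, G (a, b) ∂ν = ∫⁻ b, R.indicator G (a, b) ∂ν :=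
    (lintegral_indicator (measurable_prodMk_left hR) _).symm
  have hright (b : β) : ∫⁻ a in {a | (a, b) ∈ R}, G (a, b) ∂μ = ∫⁻ a, R.indicator G (a, b) ∂μ :=
    (lintegral_indicator (measurable_prodMk_right hR) _).symm
  simp only [hleft, hright]
  exact lintegral_lintegral_swap (f := fun a b => R.indicator G (a, b))
    (hG.indicator hR).aemeasurable

end Fiber

lemma exists_setLIntegral_le_card_mul {α ι : Type*} [MeasurableSpace α] (μ : Measure α)
    {s : Finset ι} (hs : s.Nonempty) {A : Set α} {B : ι → Set α} (hAB : A ⊆ ⋃ i ∈ s, B i)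
    (f : α → ℝ≥0∞) : ∃ i ∈ s, ∫⁻ x in A, f x ∂μ ≤ s.card * ∫⁻ x in B i, f x ∂μ := by
  obtain ⟨i, hi, hmax⟩ := s.exists_max_image (fun i => ∫⁻ x in B i, f x ∂μ) hs
  refine ⟨i, hi, ?_⟩
  calc ∫⁻ x in A, f x ∂μ ≤ ∫⁻ x in ⋃ i : s, B i, f x ∂μ :=
        lintegral_mono_set (hAB.trans_eq (by rw [iUnion_subtype]))
    _ ≤ ∑' i : s, ∫⁻ x in B i, f x ∂μ := lintegral_iUnion_le _ _
    _ = ∑ i ∈ s, ∫⁻ x in B i, f x ∂μ := Finset.tsum_subtype s fun i => ∫⁻ x in B i, f x ∂μ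
    _ ≤ s.card * ∫⁻ x in B i, f x ∂μ := by
        rw [← nsmul_eq_mul]
        exact Finset.sum_le_card_nsmul _ _ _ hmax

lemma volume_ball {n : ℕ} (x : EuclideanSpace ℝ (Fin n)) {r : ℝ} (hr : 0 < r) :
    volume (ball x r) = weight n r * volume (ball (0 : EuclideanSpace ℝ (Fin n)) 1) := by
  rw [Measure.addHaar_ball_of_pos volume x hr, weight_eq_ofReal _ hr, finrank_euclideanSpace_fin,
    Real.rpow_natCast]

namespace Whitney

section Geometry

variable {n : ℕ} {c d : Whitney} {z w ζ : Space n}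

lemma c₁_pos (c : Whitney) : 0 < c.c₁ := one_pos.trans c.one_lt_c₁

lemma isOpen_region (c : Whitney) (z : Space n) : IsOpen (c.region z) :=
  isOpen_Ioo.prod isOpen_ball

lemma measurableSet_region (c : Whitney) (z : Space n) : MeasurableSet (c.region z) :=
  (c.isOpen_region z).measurableSet

lemma mem_region : w ∈ c.region z ↔
    (c.c₁⁻¹ * z.1 < w.1 ∧ w.1 < c.c₁ * z.1) ∧ dist w.2 z.2 < c.c₀ * z.1 := Iff.rfl

lemma self_mem_region (c : Whitney) (hz : 0 < z.1) : z ∈ c.region z := by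
  refine mem_region.2 ⟨⟨?_, ?_⟩, ?_⟩
  · exact (inv_mul_lt_iff₀ c.c₁_pos).2 (lt_mul_of_one_lt_left hz c.one_lt_c₁)
  · exact lt_mul_of_one_lt_left hz c.one_lt_c₁
  · rw [dist_self]
    exact mul_pos c.c₀_pos hz

lemma lt_mul_of_mem_region (h : w ∈ c.region z) : z.1 < c.c₁ * w.1 :=
  (inv_mul_lt_iff₀ c.c₁_pos).1 (mem_region.1 h).1.1

lemma region_subset_upperHalf (c : Whitney) (hz : 0 < z.1) : c.region z ⊆ upperHalf n :=
  fun _ hw => (mul_pos (inv_pos.2 c.c₁_pos) hz).trans (mem_region.1 hw).1.1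

lemma pos_of_mem_region (hz : 0 < z.1) (hw : w ∈ c.region z) : 0 < w.1 :=
  c.region_subset_upperHalf hz hw

lemma weight_le_of_mem_region (a : ℝ) (hw : w ∈ c.region z) :
    weight a w.1 ≤ weight |a| c.c₁ * weight a z.1 :=
  weight_le_weight_abs_mul a c.c₁_pos (mem_region.1 hw).1.2.le (lt_mul_of_mem_region hw).le

lemma weight_le_of_mem_region' (a : ℝ) (hw : w ∈ c.region z) :
    weight a z.1 ≤ weight |a| c.c₁ * weight a w.1 :=
  weight_le_weight_abs_mul a c.c₁_pos (lt_mul_of_mem_region hw).le (mem_region.1 hw).1.2.le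

end Geometry

section Volume

variable {n : ℕ} {z w : Space n}

lemma volume_region (c : Whitney) (hz : 0 < z.1) :
    volume (c.region z) = weight (n + 1) z.1 * volume (c.region ((1, 0) : Space n)) := by
  rw [region, region, Measure.volume_eq_prod, Measure.prod_prod, Measure.prod_prod,
    volume_ball _ (mul_pos c.c₀_pos hz), volume_ball _ (mul_pos c.c₀_pos one_pos),
    Real.volume_Ioo, Real.volume_Ioo, mul_one, weight_mul _ c.c₀_pos, ← sub_mul, mul_comm _ z.1,
    ENNReal.ofReal_mul hz.le, ← weight_mul_weight hz rfl]
  simp only [mul_one, weight, ENNReal.rpow_one]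
  ring

lemma volume_region_ne_zero (c : Whitney) (hz : 0 < z.1) : volume (c.region z) ≠ 0 :=
  ((c.isOpen_region z).measure_pos volume ⟨z, c.self_mem_region hz⟩).ne'

lemma volume_region_ne_top (c : Whitney) (z : Space n) : volume (c.region z) ≠ ∞ := by
  rw [region, Measure.volume_eq_prod, Measure.prod_prod, Real.volume_Ioo]
  exact ENNReal.mul_ne_top ENNReal.ofReal_ne_top measure_ball_lt_top.ne

lemma exists_volume_region_le (n : ℕ) (a b e : Whitney) : ∃ C : ℝ≥0∞, C ≠ ∞ ∧
    ∀ z w : Space n, 0 < z.1 → w ∈ e.region z →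
      volume (a.region z) ≤ C * volume (b.region w) ∧
        volume (b.region w) ≤ C * volume (a.region z) := by
  set A := volume (a.region ((1, 0) : Space n))
  set B := volume (b.region ((1, 0) : Space n))
  have hA₀ : A ≠ 0 := a.volume_region_ne_zero one_pos
  have hB₀ : B ≠ 0 := b.volume_region_ne_zero one_pos
  have hA : A ≠ ∞ := a.volume_region_ne_top _
  have hB : B ≠ ∞ := b.volume_region_ne_top _
  have hE := weight_ne_top |(n : ℝ) + 1| e.c₁_pos
  refine ⟨weight |(n : ℝ) + 1| e.c₁ * (A / B + B / A), by finiteness, fun z w hz hw => ?_⟩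
  rw [a.volume_region hz, b.volume_region (pos_of_mem_region hz hw)]
  constructor
  · calc weight (n + 1) z.1 * A ≤ weight |(n : ℝ) + 1| e.c₁ * weight (n + 1) w.1 * (A / B * B) := by
          rw [ENNReal.div_mul_cancel hB₀ hB]
          gcongr
          exact weight_le_of_mem_region' _ hw
      _ = weight |(n : ℝ) + 1| e.c₁ * (A / B) * (weight (n + 1) w.1 * B) := by ring
      _ ≤ _ := by gcongr; exact le_self_add
  · calc weight (n + 1) w.1 * B ≤ weight |(n : ℝ) + 1| e.c₁ * weight (n + 1) z.1 * (B / A * A) := by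
          rw [ENNReal.div_mul_cancel hA₀ hA]
          gcongr
          exact weight_le_of_mem_region _ hw
      _ = weight |(n : ℝ) + 1| e.c₁ * (B / A) * (weight (n + 1) z.1 * A) := by ring
      _ ≤ _ := by gcongr; exact le_add_self

end Volume

section Cover

variable {n : ℕ} {c d : Whitney} {z w ζ : Space n}

/-- The closure `[d₁⁻¹ t, d₁ t] × B̄(x, d₀ t)` of a Whitney region. -/
def closedRegion (d : Whitney) (z : Space n) : Set (Space n) :=
  Icc (d.c₁⁻¹ * z.1) (d.c₁ * z.1) ×ˢ closedBall z.2 (d.c₀ * z.1)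

/-- Whitney parameters whose regions contain every `c`-region centred in the `d`-region with the
same centre. -/
def comp (c d : Whitney) : Whitney where
  c₀ := c.c₀ * d.c₁ + d.c₀
  c₁ := c.c₁ * d.c₁
  c₀_pos := add_pos (mul_pos c.c₀_pos d.c₁_pos) d.c₀_pos
  one_lt_c₁ := one_lt_mul_of_lt_of_le c.one_lt_c₁ d.one_lt_c₁.le

lemma region_subset_comp (hζ : ζ ∈ d.closedRegion z) : c.region ζ ⊆ (c.comp d).region z := by
  obtain ⟨⟨hl, hu⟩, hdist⟩ := hζ
  intro w hw
  obtain ⟨⟨hl', hu'⟩, hdist'⟩ := mem_region.1 hw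
  refine mem_region.2 ⟨⟨?_, ?_⟩, ?_⟩
  · calc (c.c₁ * d.c₁)⁻¹ * z.1 = c.c₁⁻¹ * (d.c₁⁻¹ * z.1) := by rw [mul_inv, mul_assoc]
      _ ≤ c.c₁⁻¹ * ζ.1 := mul_le_mul_of_nonneg_left hl (inv_pos.2 c.c₁_pos).le
      _ < w.1 := hl'
  · calc w.1 < c.c₁ * ζ.1 := hu'
      _ ≤ c.c₁ * (d.c₁ * z.1) := mul_le_mul_of_nonneg_left hu c.c₁_pos.le
      _ = c.c₁ * d.c₁ * z.1 := (mul_assoc _ _ _).symm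
  · calc dist w.2 z.2 ≤ dist w.2 ζ.2 + dist ζ.2 z.2 := dist_triangle _ _ _
      _ < c.c₀ * ζ.1 + d.c₀ * z.1 := add_lt_add_of_lt_of_le hdist' hdist
      _ ≤ c.c₀ * (d.c₁ * z.1) + d.c₀ * z.1 := by gcongr; exact c.c₀_pos.le
      _ = (c.c₀ * d.c₁ + d.c₀) * z.1 := by ring

lemma exists_refinement (n : ℕ) (c : Whitney) : ∃ c' : Whitney, ∀ z w : Space n, 0 < z.1 →
    w ∈ c'.region z → c'.region z ⊆ c.region w := by
  have hroot : 1 < √c.c₁ := by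
    rw [Real.lt_sqrt zero_le_one, one_pow]
    exact c.one_lt_c₁
  have hroot_pos : 0 < √c.c₁ := one_pos.trans hroot
  have hsq : √c.c₁ * √c.c₁ = c.c₁ := Real.mul_self_sqrt c.c₁_pos.le
  refine ⟨⟨c.c₀ / (2 * √c.c₁), √c.c₁, div_pos c.c₀_pos (mul_pos two_pos hroot_pos), hroot⟩, ?_⟩
  intro z w hz hw v hv
  have hzw : z.1 < √c.c₁ * w.1 := lt_mul_of_mem_region hw
  have hzv : z.1 < √c.c₁ * v.1 := lt_mul_of_mem_region hv
  obtain ⟨⟨-, hwz⟩, hdist⟩ := mem_region.1 hw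
  obtain ⟨⟨-, hvz⟩, hdist'⟩ := mem_region.1 hv
  simp only at hwz hvz hdist hdist'
  refine mem_region.2 ⟨⟨?_, ?_⟩, ?_⟩
  · rw [inv_mul_lt_iff₀ c.c₁_pos]
    nlinarith
  · nlinarith
  · have hhalf : c.c₀ / (2 * √c.c₁) * z.1 ≤ c.c₀ / 2 * w.1 := by
      rw [div_mul_eq_mul_div, div_le_iff₀ (by positivity)]
      nlinarith [c.c₀_pos]
    linarith [dist_triangle_right v.2 w.2 z.2]

/-- The affine map carrying `(1, 0)` to `z`; Whitney regions are invariant under these maps. -/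
def translateDilate (z ζ : Space n) : Space n := (z.1 * ζ.1, z.2 + z.1 • ζ.2)

lemma translateDilate_mem_region_translateDilate (hz : 0 < z.1) :
    translateDilate z w ∈ c.region (translateDilate z ζ) ↔ w ∈ c.region ζ := by
  have hdist : dist (z.2 + z.1 • w.2) (z.2 + z.1 • ζ.2) = z.1 * dist w.2 ζ.2 := by
    rw [dist_add_left, dist_smul₀, Real.norm_of_nonneg hz.le]
  simp only [mem_region, translateDilate, hdist, mul_left_comm _ z.1, mul_lt_mul_iff_right₀ hz]

lemma translateDilate_mem_region (hz : 0 < z.1) :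
    translateDilate z w ∈ c.region z ↔ w ∈ c.region (1, 0) := by
  have hz_eq : translateDilate z (1, 0) = z := by simp [translateDilate]
  simpa only [hz_eq] using translateDilate_mem_region_translateDilate (c := c) (ζ := (1, 0)) hz

lemma exists_translateDilate_eq (hz : 0 < z.1) (w : Space n) : ∃ v, translateDilate z v = w :=
  ⟨(z.1⁻¹ * w.1, z.1⁻¹ • (w.2 - z.2)), by
    simp [translateDilate, mul_inv_cancel_left₀ hz.ne', smul_inv_smul₀ hz.ne']⟩

lemma exists_finset_cover (n : ℕ) (c d : Whitney) : ∃ (e : Whitney) (s : Finset (Space n)),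
    ∀ z : Space n, 0 < z.1 → (d.region z ⊆ ⋃ ζ ∈ s, c.region (translateDilate z ζ)) ∧
      ∀ ζ ∈ s, c.region (translateDilate z ζ) ⊆ e.region z ∧ 0 < (translateDilate z ζ).1 := by
  have hK : IsCompact (d.closedRegion ((1, 0) : Space n)) :=
    isCompact_Icc.prod (isCompact_closedBall _ _)
  have hK_pos {ζ : Space n} (hζ : ζ ∈ d.closedRegion (1, 0)) : 0 < ζ.1 :=
    (mul_pos (inv_pos.2 d.c₁_pos) one_pos).trans_le hζ.1.1
  obtain ⟨s, hsK, hs⟩ := hK.elim_nhds_subcover c.region fun ζ hζ =>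
    (c.isOpen_region ζ).mem_nhds (c.self_mem_region (hK_pos hζ))
  refine ⟨c.comp d, s, fun z hz => ⟨fun w hw => ?_, fun ζ hζ => ⟨fun w hw => ?_, ?_⟩⟩⟩
  · obtain ⟨v, rfl⟩ := exists_translateDilate_eq hz w
    rw [translateDilate_mem_region hz] at hw
    have hv : v ∈ d.closedRegion (1, 0) := prod_mono Ioo_subset_Icc_self ball_subset_closedBall hw
    simpa only [mem_iUnion₂, translateDilate_mem_region_translateDilate hz] using hs hv
  · obtain ⟨v, rfl⟩ := exists_translateDilate_eq hz w
    rw [translateDilate_mem_region hz]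
    exact region_subset_comp (hsK ζ hζ) ((translateDilate_mem_region_translateDilate hz).1 hw)
  · exact mul_pos hz (hK_pos (hsK ζ hζ))

end Cover

end Whitney

lemma rpow_half_sq (K : ℝ≥0∞) : (K ^ (1 / 2 : ℝ)) ^ 2 = K := by
  rw [← ENNReal.rpow_two, ← ENNReal.rpow_mul, one_div_mul_cancel two_ne_zero, ENNReal.rpow_one]

lemma le_rpow_half_mul_of_sq_le {x y K : ℝ≥0∞} (h : x ^ 2 ≤ K * y ^ 2) :
    x ≤ K ^ (1 / 2 : ℝ) * y := by
  rwa [← ENNReal.pow_le_pow_left_iff two_ne_zero, mul_pow, rpow_half_sq]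

namespace Whitney

variable {n : ℕ} {F : Type*} [NormedAddCommGroup F]

lemma average_sq (c : Whitney) (u : Space n → F) (z : Space n) :
    c.average u z ^ 2 = (∫⁻ w in c.region z, ‖u w‖ₑ ^ 2) / volume (c.region z) := by
  rw [average, rpow_half_sq, setLAverage_eq]

lemma volume_region_mul_average_sq (c : Whitney) (u : Space n → F) {z : Space n} (hz : 0 < z.1) :
    volume (c.region z) * c.average u z ^ 2 = ∫⁻ w in c.region z, ‖u w‖ₑ ^ 2 := by
  rw [average_sq,
    ENNReal.mul_div_cancel (c.volume_region_ne_zero hz) (c.volume_region_ne_top z)]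

lemma average_le_mul {c : Whitney} {u v : Space n → F} {z : Space n} {K : ℝ≥0∞}
    (hK : K ≠ ∞) (h : ∀ w ∈ c.region z, ‖u w‖ₑ ≤ K * ‖v w‖ₑ) :
    c.average u z ≤ K * c.average v z := by
  rw [← ENNReal.pow_le_pow_left_iff two_ne_zero, mul_pow, average_sq, average_sq, ← mul_div_assoc,
    ← lintegral_const_mul' _ _ (ENNReal.pow_ne_top hK)]
  gcongr ?_ / _
  refine setLIntegral_mono' (c.measurableSet_region z) fun w hw => ?_
  rw [← mul_pow]
  gcongr
  exact h w hw

lemma measurableSet_region_rel (c : Whitney) :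
    MeasurableSet {q : Space n × Space n | q.2 ∈ c.region q.1} := by
  simp only [mem_region]
  exact ((measurableSet_lt (f := fun q : Space n × Space n => c.c₁⁻¹ * q.1.1)
    (by fun_prop) (by fun_prop)).inter (measurableSet_lt
      (f := fun q : Space n × Space n => q.2.1) (by fun_prop) (by fun_prop))).inter
    (measurableSet_lt (f := fun q : Space n × Space n => dist q.2.2 q.1.2)
      (by fun_prop) (by fun_prop))

lemma measurable_average (c : Whitney) {u : Space n → F} (hu : Measurable fun z => ‖u z‖ₑ) :
    Measurable (c.average u) := by
  unfold average
  simp only [setLAverage_eq]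
  refine (Measurable.div ?_ ?_).pow_const _
  · exact measurable_setLIntegral_fiber volume c.measurableSet_region_rel
      ((hu.comp measurable_snd).pow_const 2)
  · simpa using measurable_setLIntegral_fiber volume c.measurableSet_region_rel measurable_one

theorem exists_average_le (n : ℕ) (F : Type*) [NormedAddCommGroup F] (c d : Whitney) :
    ∃ (e : Whitney) (C : ℝ≥0∞), C ≠ ∞ ∧ ∀ (u : Space n → F) (z : Space n), 0 < z.1 →
      ∃ U ⊆ e.region z, MeasurableSet U ∧ volume (e.region z) ≤ C * volume U ∧
        ∀ w ∈ U, d.average u z ≤ C * c.average u w := by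
  obtain ⟨c', hc'⟩ := exists_refinement n c
  obtain ⟨e, s, hes⟩ := exists_finset_cover n c' d
  obtain ⟨C₁, hC₁, hvol⟩ := exists_volume_region_le n d c e
  obtain ⟨C₂, hC₂, hvol'⟩ := exists_volume_region_le n e c' e
  refine ⟨e, C₂ + (s.card * C₁) ^ (1 / 2 : ℝ), by finiteness, fun u z hz => ?_⟩
  obtain ⟨hcover, hpiece⟩ := hes z hz
  have hs : s.Nonempty := by
    obtain ⟨ζ, hζ, -⟩ := mem_iUnion₂.1 (hcover (d.self_mem_region hz))
    exact ⟨ζ, hζ⟩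
  obtain ⟨ζ, hζ, hlarge⟩ := exists_setLIntegral_le_card_mul volume hs hcover fun w => ‖u w‖ₑ ^ 2
  obtain ⟨hsub, hpos⟩ := hpiece ζ hζ
  refine ⟨_, hsub, c'.measurableSet_region _, ?_, fun w hw => ?_⟩
  · refine (hvol' z _ hz (hsub (c'.self_mem_region hpos))).1.trans ?_
    gcongr
    exact le_self_add
  · suffices d.average u z ^ 2 ≤ s.card * C₁ * c.average u w ^ 2 by
      refine (le_rpow_half_mul_of_sq_le this).trans ?_
      gcongr
      exact le_add_self
    rw [average_sq]
    refine ENNReal.div_le_of_le_mul ?_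
    calc ∫⁻ v in d.region z, ‖u v‖ₑ ^ 2
        ≤ s.card * ∫⁻ v in c.region w, ‖u v‖ₑ ^ 2 := by
          refine hlarge.trans ?_
          gcongr
          exact hc' _ _ hpos hw
      _ = s.card * (volume (c.region w) * c.average u w ^ 2) := by
          rw [volume_region_mul_average_sq _ _ (pos_of_mem_region hz (hsub hw))]
      _ ≤ s.card * (C₁ * volume (d.region z) * c.average u w ^ 2) := by
          gcongr
          exact (hvol z w hz (hsub hw)).2
      _ = s.card * C₁ * c.average u w ^ 2 * volume (d.region z) := by ring

lemma exists_average_rpow_le (n : ℕ) (F : Type*) [NormedAddCommGroup F] (c d : Whitney) {p : ℝ}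
    (hp : 0 < p) :
    ∃ (e : Whitney) (C : ℝ≥0∞), C ≠ ∞ ∧ ∀ u : Space n → F, (Measurable fun z => ‖u z‖ₑ) →
      ∀ z : Space n, 0 < z.1 →
        d.average u z ^ p ≤ C * ⨍⁻ w in e.region z, c.average u w ^ p ∂volume := by
  obtain ⟨e, C, hC, h⟩ := exists_average_le n F c d
  refine ⟨e, C ^ p * C, by finiteness, fun u hu z hz => ?_⟩
  obtain ⟨U, hUe, -, hvol, hU⟩ := h u z hz
  have hU₀ : volume U ≠ 0 := fun h₀ =>
    e.volume_region_ne_zero hz (le_zero_iff.1 (hvol.trans (by simp [h₀])))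
  have hU_top : volume U ≠ ∞ := measure_ne_top_of_subset hUe (e.volume_region_ne_top z)
  obtain ⟨w, hw, hle⟩ := exists_le_setLAverage hU₀ hU_top
    ((c.measurable_average hu).pow_const p).aemeasurable
  calc d.average u z ^ p ≤ (C * c.average u w) ^ p := by gcongr; exact hU w hw
    _ = C ^ p * c.average u w ^ p := ENNReal.mul_rpow_of_nonneg _ _ hp.le
    _ ≤ C ^ p * ((∫⁻ v in e.region z, c.average u v ^ p) * (C / volume (e.region z))) := by
        gcongr
        refine hle.trans ?_
        rw [setLAverage_eq, ENNReal.div_eq_inv_mul, mul_comm]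
        gcongr
        rw [ENNReal.le_div_iff_mul_le (Or.inl (e.volume_region_ne_zero hz))
          (Or.inl (e.volume_region_ne_top z)), ENNReal.inv_mul_le_iff hU₀ hU_top, mul_comm]
        exact hvol
    _ = C ^ p * C * ⨍⁻ v in e.region z, c.average u v ^ p ∂volume := by
        rw [setLAverage_eq, div_eq_mul_inv, div_eq_mul_inv]
        ring

lemma exists_average_le_eLpNorm_top (n : ℕ) (F : Type*) [NormedAddCommGroup F] (c d : Whitney) :
    ∃ C : ℝ≥0∞, C ≠ ∞ ∧ ∀ (u : Space n → F) (z : Space n), 0 < z.1 →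
      d.average u z ≤ C * eLpNorm (c.average u) ∞ (haarUpper n) := by
  obtain ⟨e, C, hC, h⟩ := exists_average_le n F c d
  refine ⟨C, hC, fun u z hz => ?_⟩
  obtain ⟨U, hUe, -, hvol, hU⟩ := h u z hz
  have hU₀ : volume U ≠ 0 := fun h₀ =>
    e.volume_region_ne_zero hz (le_zero_iff.1 (hvol.trans (by simp [h₀])))
  have hae : ∀ᵐ w ∂haarUpper n, c.average u w ≤ eLpNorm (c.average u) ∞ (haarUpper n) := by
    simpa using enorm_ae_le_eLpNormEssSup (c.average u) (haarUpper n)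
  obtain ⟨w, hw, hle⟩ := Measure.exists_mem_of_measure_ne_zero_of_ae
    (haarUpper_ne_zero (hUe.trans (e.region_subset_upperHalf hz)) hU₀) (ae_restrict_of_ae hae)
  exact (hU w hw).trans (mul_le_mul_right hle C)

end Whitney

lemma inv_two_le_haarIoi_Ioo {t : ℝ} (ht : 0 < t) : 2⁻¹ ≤ haarIoi (Ioo (t / 2) t) := by
  have hpos : Ioo (t / 2) t ⊆ Ioi 0 := fun s hs => (half_pos ht).trans hs.1
  calc (2⁻¹ : ℝ≥0∞) = weight (-1) t * volume (Ioo (t / 2) t) := by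
        rw [Real.volume_Ioo, sub_half, weight_eq_ofReal _ ht, Real.rpow_neg_one,
          ← ENNReal.ofReal_mul (inv_pos.2 ht).le, mul_div_assoc', inv_mul_cancel₀ ht.ne', one_div,
          ENNReal.ofReal_inv_of_pos two_pos, ENNReal.ofReal_ofNat]
    _ = ∫⁻ _ in Ioo (t / 2) t, weight (-1) t := (setLIntegral_const _ _).symm
    _ ≤ ∫⁻ s in Ioo (t / 2) t, weight (-1) s * 1 := by
        refine setLIntegral_mono' measurableSet_Ioo fun s hs => ?_
        rw [mul_one]
        exact weight_anti (by norm_num) hs.2.le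
    _ = haarIoi (Ioo (t / 2) t) := by
        rw [← setLIntegral_haarIoi measurableSet_Ioo hpos, setLIntegral_one]

section Cone

variable {n : ℕ} {a b : ℝ} {y : EuclideanSpace ℝ (Fin n)} {z : Space n} {φ : Space n → ℝ≥0∞}

/-- The cone of aperture `a` with vertex `y`. -/
def wideCone (a : ℝ) (y : EuclideanSpace ℝ (Fin n)) : Set (Space n) :=
  {z | 0 < z.1 ∧ dist z.2 y < a * z.1}

/-- The integral of `t⁻ⁿ φ(t, x)` with respect to `dx dt / t` over the cone of aperture `a` with
vertex `y`. -/
def coneIntegral (a : ℝ) (φ : Space n → ℝ≥0∞) (y : EuclideanSpace ℝ (Fin n)) : ℝ≥0∞ :=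
  ∫⁻ z in wideCone a y, weight (-n) z.1 * φ z ∂haarUpper n

lemma wideCone_subset_upperHalf : wideCone a y ⊆ upperHalf n := fun _ hz => hz.1

lemma wideCone_one (y : EuclideanSpace ℝ (Fin n)) : wideCone 1 y = cone y := by
  simp [wideCone, cone]

lemma measurableSet_wideCone_rel (a : ℝ) :
    MeasurableSet {q : EuclideanSpace ℝ (Fin n) × Space n | q.2 ∈ wideCone a q.1} :=
  (measurableSet_lt (f := fun _ => (0 : ℝ)) (by fun_prop) (by fun_prop)).inter
    (measurableSet_lt (f := fun q : EuclideanSpace ℝ (Fin n) × Space n => dist q.2.2 q.1)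
      (by fun_prop) (by fun_prop))

lemma measurableSet_wideCone (a : ℝ) (y : EuclideanSpace ℝ (Fin n)) :
    MeasurableSet (wideCone a y) :=
  measurable_prodMk_left (measurableSet_wideCone_rel a)

lemma measurable_weight_fst_mul (a : ℝ) (hφ : Measurable φ) :
    Measurable fun z => weight a z.1 * φ z :=
  ((measurable_weight a).comp measurable_fst).mul hφ

lemma conical_sq {F : Type*} [NormedAddCommGroup F] (u : Space n → F)
    (y : EuclideanSpace ℝ (Fin n)) :
    conical u y ^ 2 = coneIntegral 1 (fun z => ‖u z‖ₑ ^ 2) y := by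
  rw [coneIntegral,
    setLIntegral_haarUpper (measurableSet_wideCone 1 y) wideCone_subset_upperHalf, conical,
    rpow_half_sq, ← wideCone_one]
  refine setLIntegral_congr_fun (measurableSet_wideCone 1 y) fun z hz => ?_
  have hz₀ : 0 < z.1 := hz.1
  calc ‖u z‖ₑ ^ 2 * ENNReal.ofReal (1 / z.1 ^ (n + 1))
      = ‖u z‖ₑ ^ 2 * ENNReal.ofReal (z.1 ^ (-n : ℝ) * (1 / z.1)) := by
        rw [Real.rpow_neg hz₀.le, Real.rpow_natCast, pow_succ z.1, one_div, one_div, mul_inv]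
    _ = weight (-n) z.1 * ‖u z‖ₑ ^ 2 * ENNReal.ofReal (1 / z.1) := by
        rw [ENNReal.ofReal_mul (Real.rpow_nonneg hz₀.le _), weight_eq_ofReal _ hz₀]
        ring

lemma lintegral_coneIntegral (ha : 0 < a) (hφ : Measurable φ) :
    ∫⁻ y, coneIntegral a φ y
      = volume (ball (0 : EuclideanSpace ℝ (Fin n)) a) * ∫⁻ z, φ z ∂haarUpper n := by
  calc ∫⁻ y, coneIntegral a φ y
      = ∫⁻ z, ∫⁻ _ in {y | z ∈ wideCone a y}, weight (-n) z.1 * φ z ∂volume ∂haarUpper n :=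
        lintegral_setLIntegral_fiber_swap (haarUpper n) volume (measurableSet_wideCone_rel a)
          ((measurable_weight_fst_mul (-n) hφ).comp measurable_snd)
    _ = ∫⁻ z, volume (ball (0 : EuclideanSpace ℝ (Fin n)) a) * φ z ∂haarUpper n := by
        refine lintegral_congr_ae ?_
        filter_upwards [ae_haarUpper_pos] with z hz
        have hfiber : {y | z ∈ wideCone a y} = ball z.2 (a * z.1) := by
          ext y
          simp [wideCone, hz, dist_comm]
        rw [setLIntegral_const, hfiber, volume_ball _ (mul_pos ha hz), volume_ball 0 ha,
          weight_mul _ ha, mul_right_comm (weight n a), mul_comm (weight (-n) z.1 * φ z),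
          ← mul_assoc, mul_assoc _ (weight n z.1), weight_mul_weight hz (add_neg_cancel _),
          weight_zero, mul_one]
    _ = volume (ball (0 : EuclideanSpace ℝ (Fin n)) a) * ∫⁻ z, φ z ∂haarUpper n :=
        lintegral_const_mul _ hφ

namespace Whitney

lemma region_subset_wideCone (c : Whitney) (hz : z ∈ wideCone b y) :
    c.region z ⊆ wideCone ((c.c₀ + |b|) * c.c₁) y := by
  intro w hw
  refine ⟨pos_of_mem_region hz.1 hw, ?_⟩
  calc dist w.2 y ≤ dist w.2 z.2 + dist z.2 y := dist_triangle _ _ _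
    _ < c.c₀ * z.1 + b * z.1 := add_lt_add (mem_region.1 hw).2 hz.2
    _ ≤ (c.c₀ + |b|) * z.1 := by
        rw [add_mul]
        gcongr
        · exact hz.1.le
        · exact le_abs_self b
    _ ≤ (c.c₀ + |b|) * (c.c₁ * w.1) := by
        gcongr
        · exact (add_pos_of_pos_of_nonneg c.c₀_pos (abs_nonneg b)).le
        · exact (lt_mul_of_mem_region hw).le
    _ = (c.c₀ + |b|) * c.c₁ * w.1 := (mul_assoc _ _ _).symm

lemma setLIntegral_region_haarUpper (c : Whitney) (hz : 0 < z.1) (φ : Space n → ℝ≥0∞) :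
    ∫⁻ w in c.region z, weight (-n) w.1 * φ w ∂haarUpper n
      = ∫⁻ w in c.region z, weight (-(n + 1)) w.1 * φ w := by
  rw [setLIntegral_haarUpper (c.measurableSet_region z) (c.region_subset_upperHalf hz)]
  refine setLIntegral_congr_fun (c.measurableSet_region z) fun w hw => ?_
  have hw₀ := pos_of_mem_region hz hw
  rw [one_div, ← Real.rpow_neg_one, ← weight_eq_ofReal _ hw₀, mul_right_comm,
    weight_mul_weight hw₀ (by ring : -(n : ℝ) + -1 = -(n + 1))]

lemma exists_setLAverage_region_le (n : ℕ) (c : Whitney) : ∃ C : ℝ≥0∞, C ≠ ∞ ∧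
    ∀ (φ : Space n → ℝ≥0∞) (z : Space n), 0 < z.1 →
      ⨍⁻ w in c.region z, φ w ∂volume
        ≤ C * ∫⁻ w in c.region z, weight (-n) w.1 * φ w ∂haarUpper n := by
  set V := volume (c.region ((1, 0) : Space n))
  set k := weight |-((n : ℝ) + 1)| c.c₁
  have hV₀ : V ≠ 0 := c.volume_region_ne_zero one_pos
  have hk : k ≠ ∞ := weight_ne_top _ c.c₁_pos
  refine ⟨V⁻¹ * k, by finiteness, fun φ z hz => ?_⟩
  calc ⨍⁻ w in c.region z, φ w ∂volume
      = V⁻¹ * ∫⁻ w in c.region z, weight (-(n + 1)) z.1 * φ w := by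
        rw [lintegral_const_mul' _ _ (weight_ne_top _ hz), setLAverage_eq, c.volume_region hz,
          ENNReal.div_eq_inv_mul, ENNReal.mul_inv (Or.inl (weight_ne_zero _ hz)) (Or.inr hV₀),
          inv_weight, mul_comm _ V⁻¹, mul_assoc]
    _ ≤ V⁻¹ * ∫⁻ w in c.region z, k * (weight (-(n + 1)) w.1 * φ w) := by
        gcongr 1
        refine setLIntegral_mono' (c.measurableSet_region z) fun w hw => ?_
        rw [← mul_assoc]
        gcongr
        exact weight_le_of_mem_region' _ hw
    _ = V⁻¹ * k * ∫⁻ w in c.region z, weight (-n) w.1 * φ w ∂haarUpper n := by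
        rw [setLIntegral_region_haarUpper c hz, lintegral_const_mul' _ _ hk, mul_assoc]

lemma exists_setLIntegral_region_le (n : ℕ) (c : Whitney) : ∃ C : ℝ≥0∞, C ≠ ∞ ∧
    ∀ (φ : Space n → ℝ≥0∞) (z : Space n), 0 < z.1 →
      ∫⁻ w in c.region z, weight (-n) w.1 * φ w ∂haarUpper n
        ≤ C * ⨍⁻ w in c.region z, φ w ∂volume := by
  set V := volume (c.region ((1, 0) : Space n))
  set k := weight |-((n : ℝ) + 1)| c.c₁
  have hV : V ≠ ∞ := c.volume_region_ne_top _
  have hk : k ≠ ∞ := weight_ne_top _ c.c₁_pos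
  refine ⟨k * V, by finiteness, fun φ z hz => ?_⟩
  have hz' := weight_ne_top (-((n : ℝ) + 1)) hz
  calc ∫⁻ w in c.region z, weight (-n) w.1 * φ w ∂haarUpper n
      = ∫⁻ w in c.region z, weight (-(n + 1)) w.1 * φ w := setLIntegral_region_haarUpper c hz φ
    _ ≤ ∫⁻ w in c.region z, k * weight (-(n + 1)) z.1 * φ w := by
        refine setLIntegral_mono' (c.measurableSet_region z) fun w hw => ?_
        gcongr
        exact weight_le_of_mem_region _ hw
    _ = k * weight (-(n + 1)) z.1
          * (volume (c.region z) * ⨍⁻ w in c.region z, φ w ∂volume) := by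
        rw [lintegral_const_mul' _ _ (by finiteness), setLAverage_eq,
          ENNReal.mul_div_cancel (c.volume_region_ne_zero hz) (c.volume_region_ne_top z)]
    _ = weight (-(n + 1)) z.1 * weight (n + 1) z.1
          * (k * V * ⨍⁻ w in c.region z, φ w ∂volume) := by
        rw [c.volume_region hz]
        ring
    _ = k * V * ⨍⁻ w in c.region z, φ w ∂volume := by rw [weight_neg_mul_self _ hz, one_mul]

end Whitney

end Cone

section NontangentialMax

variable {n : ℕ}

/-- The nontangential maximal function over the cones of aperture `1 / 4`. -/
def nontangentialMax (u : Space n → ℝ≥0∞) (y : EuclideanSpace ℝ (Fin n)) : ℝ≥0∞ :=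
  ⨆ z ∈ wideCone (1 / 4) y, u z

lemma measurable_nontangentialMax (u : Space n → ℝ≥0∞) : Measurable (nontangentialMax u) := by
  refine LowerSemicontinuous.measurable fun y K hK => ?_
  obtain ⟨z, hz⟩ := lt_iSup_iff.1 hK
  obtain ⟨hzy, hz⟩ := lt_iSup_iff.1 hz
  have hopen : IsOpen {x | dist z.2 x < 1 / 4 * z.1} := isOpen_lt (by fun_prop) (by fun_prop)
  filter_upwards [hopen.mem_nhds hzy.2] with x hx
  exact hz.trans_le (le_iSup₂_of_le z ⟨hzy.1, hx⟩ le_rfl)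

/-- Whitney parameters whose regions centred in a cone of aperture `1 / 4` stay in the cone of
aperture `1` with the same vertex. -/
def smallWhitney : Whitney := ⟨1 / 4, 2, by norm_num, by norm_num⟩

lemma exists_nontangentialMax_le_conical (n : ℕ) (F : Type*) [NormedAddCommGroup F] :
    ∃ C : ℝ≥0∞, C ≠ ∞ ∧ ∀ (u : Space n → F) (y : EuclideanSpace ℝ (Fin n)),
      nontangentialMax (smallWhitney.average u) y ≤ C * conical u y := by
  obtain ⟨C, hC, h⟩ := Whitney.exists_setLAverage_region_le n smallWhitney
  refine ⟨C ^ (1 / 2 : ℝ), by finiteness, fun u y => iSup₂_le fun z hz => ?_⟩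
  have hsub : smallWhitney.region z ⊆ wideCone 1 y := by
    convert smallWhitney.region_subset_wideCone hz using 1
    norm_num [smallWhitney]
  refine le_rpow_half_mul_of_sq_le ?_
  calc smallWhitney.average u z ^ 2 = ⨍⁻ w in smallWhitney.region z, ‖u w‖ₑ ^ 2 ∂volume := by
        rw [Whitney.average_sq, setLAverage_eq]
    _ ≤ C * ∫⁻ w in smallWhitney.region z, weight (-n) w.1 * ‖u w‖ₑ ^ 2 ∂haarUpper n :=
        h _ z hz.1
    _ ≤ C * coneIntegral 1 (fun w => ‖u w‖ₑ ^ 2) y := by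
        gcongr
        exact lintegral_mono_set hsub
    _ = C * conical u y ^ 2 := by rw [conical_sq]

lemma exists_nontangentialMax_rpow_le (n : ℕ) (F : Type*) [NormedAddCommGroup F] (c d : Whitney)
    {p : ℝ} (hp : 0 < p) :
    ∃ a > 0, ∃ C : ℝ≥0∞, C ≠ ∞ ∧ ∀ u : Space n → F, (Measurable fun z => ‖u z‖ₑ) →
      ∀ y : EuclideanSpace ℝ (Fin n),
        nontangentialMax (d.average u) y ^ p
          ≤ C * coneIntegral a (fun z => c.average u z ^ p) y := by
  obtain ⟨e, C₁, hC₁, h₁⟩ := Whitney.exists_average_rpow_le n F c d hp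
  obtain ⟨C₂, hC₂, h₂⟩ := Whitney.exists_setLAverage_region_le n e
  refine ⟨(e.c₀ + |1 / 4|) * e.c₁, mul_pos (add_pos e.c₀_pos (by norm_num)) e.c₁_pos,
    C₁ * C₂, by finiteness, fun u hu y => ?_⟩
  rw [← ENNReal.le_rpow_inv_iff hp]
  refine iSup₂_le fun z hz => ?_
  rw [ENNReal.le_rpow_inv_iff hp]
  calc d.average u z ^ p ≤ C₁ * ⨍⁻ w in e.region z, c.average u w ^ p ∂volume := h₁ u hu z hz.1
    _ ≤ C₁ * (C₂ * ∫⁻ w in e.region z, weight (-n) w.1 * c.average u w ^ p ∂haarUpper n) := by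
        gcongr
        exact h₂ _ z hz.1
    _ ≤ C₁ * (C₂ * coneIntegral _ (fun w => c.average u w ^ p) y) := by
        gcongr
        exact lintegral_mono_set (e.region_subset_wideCone hz)
    _ = C₁ * C₂ * coneIntegral _ (fun w => c.average u w ^ p) y := (mul_assoc _ _ _).symm

end NontangentialMax

section Conical

variable {n : ℕ}

/-- Whitney parameters whose regions centred on a vertical axis cover the cone around that axis. -/
def bigWhitney : Whitney := ⟨2, 2, by norm_num, by norm_num⟩

lemma mem_bigWhitney_region {z : Space n} {y : EuclideanSpace ℝ (Fin n)} (hz : z ∈ wideCone 1 y)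
    {t : ℝ} (ht : t ∈ Ioo (z.1 / 2) z.1) : z ∈ bigWhitney.region (t, y) := by
  have hhalf : z.1 < 2 * t := (div_lt_iff₀' two_pos).1 ht.1
  refine Whitney.mem_region.2 ⟨⟨?_, hhalf⟩, ?_⟩
  · exact (inv_mul_lt_iff₀ two_pos).2 (ht.2.trans (lt_mul_of_one_lt_left hz.1 one_lt_two))
  · exact hz.2.trans (by rwa [one_mul])

lemma exists_coneIntegral_le (n : ℕ) :
    ∃ C : ℝ≥0∞, C ≠ ∞ ∧ ∀ φ : Space n → ℝ≥0∞, Measurable φ → ∀ y : EuclideanSpace ℝ (Fin n),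
      coneIntegral 1 φ y ≤ C * ∫⁻ t, ⨍⁻ w in bigWhitney.region (t, y), φ w ∂volume ∂haarIoi := by
  obtain ⟨C, hC, h⟩ := Whitney.exists_setLIntegral_region_le n bigWhitney
  refine ⟨2 * C, by finiteness, fun φ hφ y => ?_⟩
  set ψ : Space n → ℝ≥0∞ := fun z => weight (-n) z.1 * φ z
  have hψ : Measurable ψ := measurable_weight_fst_mul _ hφ
  have hR : MeasurableSet {q : ℝ × Space n | q.2 ∈ bigWhitney.region (q.1, y)} :=
    bigWhitney.measurableSet_region_rel.preimage
      (by fun_prop : Measurable fun q : ℝ × Space n => (((q.1, y) : Space n), q.2))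
  calc coneIntegral 1 φ y = 2 * ∫⁻ z in wideCone 1 y, 2⁻¹ * ψ z ∂haarUpper n := by
        rw [lintegral_const_mul _ hψ, ← mul_assoc, ENNReal.mul_inv_cancel two_ne_zero (by simp),
          one_mul]
        rfl
    _ ≤ 2 * ∫⁻ z in wideCone 1 y,
          ∫⁻ _ in {t | z ∈ bigWhitney.region (t, y)}, ψ z ∂haarIoi ∂haarUpper n := by
        gcongr 1
        refine setLIntegral_mono' (measurableSet_wideCone 1 y) fun z hz => ?_
        rw [setLIntegral_const, mul_comm]
        gcongr
        exact (inv_two_le_haarIoi_Ioo hz.1).trans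
          (measure_mono fun t ht => mem_bigWhitney_region hz ht)
    _ ≤ 2 * ∫⁻ z, ∫⁻ _ in {t | z ∈ bigWhitney.region (t, y)}, ψ z ∂haarIoi ∂haarUpper n := by
        gcongr 1
        exact setLIntegral_le_lintegral _ _
    _ = 2 * ∫⁻ t, ∫⁻ z in bigWhitney.region (t, y), ψ z ∂haarUpper n ∂haarIoi := by
        congr 1
        exact (lintegral_setLIntegral_fiber_swap (haarUpper n) haarIoi hR
          (hψ.comp measurable_snd)).symm
    _ ≤ 2 * ∫⁻ t, C * ⨍⁻ w in bigWhitney.region (t, y), φ w ∂volume ∂haarIoi := by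
        gcongr 1
        refine lintegral_mono_ae ?_
        filter_upwards [ae_haarIoi_pos] with t ht using h φ (t, y) ht
    _ = 2 * C * ∫⁻ t, ⨍⁻ w in bigWhitney.region (t, y), φ w ∂volume ∂haarIoi := by
        rw [lintegral_const_mul' _ _ hC, mul_assoc]

lemma exists_conical_sq_le (n : ℕ) (F : Type*) [NormedAddCommGroup F] :
    ∃ C : ℝ≥0∞, C ≠ ∞ ∧ ∀ u : Space n → F, (Measurable fun z => ‖u z‖ₑ) →
      ∀ y : EuclideanSpace ℝ (Fin n),
        conical u y ^ 2 ≤ C * ∫⁻ t, bigWhitney.average u (t, y) ^ 2 ∂haarIoi := by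
  obtain ⟨C, hC, h⟩ := exists_coneIntegral_le n
  refine ⟨C, hC, fun u hu y => ?_⟩
  simp only [conical_sq, Whitney.average_sq, ← setLAverage_eq]
  exact h _ (hu.pow_const 2) y

end Conical

section Carleson

variable {n : ℕ} {F : Type*} [NormedAddCommGroup F]

lemma measurableSet_tent (x : EuclideanSpace ℝ (Fin n)) (r : ℝ) : MeasurableSet (tent x r) :=
  (measurableSet_lt (f := fun _ => (0 : ℝ)) (by fun_prop) (by fun_prop)).inter
    (measurableSet_le (f := fun z : Space n => dist z.2 x + z.1) (by fun_prop) (by fun_prop))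

lemma carleson_le_iff {α : ℝ} {u : Space n → F} {K : ℝ≥0∞} :
    carleson α u ≤ K ↔ ∀ (x : EuclideanSpace ℝ (Fin n)) (r : ℝ), 0 < r →
      ∫⁻ z in tent x r, ‖u z‖ₑ ^ 2 ∂haarUpper n ≤ volume (ball x r) * (weight α r * K) ^ 2 := by
  simp only [carleson, iSup_le_iff]
  refine forall₃_congr fun x r hr => ?_
  have hB₀ : volume (ball x r) ≠ 0 := (measure_ball_pos volume x hr).ne'
  have hB : volume (ball x r) ≠ ∞ := measure_ball_lt_top.ne
  rw [setLIntegral_haarUpper (measurableSet_tent x r) fun z hz => hz.1, ← weight_eq_ofReal _ hr,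
    ← inv_weight, ENNReal.inv_mul_le_iff (weight_ne_zero α hr) (weight_ne_top α hr),
    one_div, ENNReal.rpow_inv_le_iff two_pos, ENNReal.rpow_two, ENNReal.inv_mul_le_iff hB₀ hB]

lemma exists_average_le_carleson (c : Whitney) (n : ℕ) (F : Type*) [NormedAddCommGroup F] (α : ℝ) :
    ∃ C : ℝ≥0∞, C ≠ ∞ ∧ ∀ (u : Space n → F) (z : Space n), 0 < z.1 →
      c.average u z ≤ C * (weight α z.1 * carleson α u) := by
  obtain ⟨C, hC, h⟩ := c.exists_setLAverage_region_le n
  set l : ℝ := c.c₀ + c.c₁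
  have hl : 0 < l := add_pos c.c₀_pos c.c₁_pos
  have hl' := weight_ne_top n hl
  have hlα := weight_ne_top α hl
  have hk := weight_ne_top |-(n : ℝ)| c.c₁_pos
  set V := volume (ball (0 : EuclideanSpace ℝ (Fin n)) 1)
  have hV : V ≠ ∞ := measure_ball_lt_top.ne
  set k := weight |-(n : ℝ)| c.c₁
  refine ⟨(C * k * weight n l * V * weight α l ^ 2) ^ (1 / 2 : ℝ), by finiteness,
    fun u z hz => le_rpow_half_mul_of_sq_le ?_⟩
  have hsub : c.region z ⊆ tent z.2 (l * z.1) := fun w hw => by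
    obtain ⟨⟨-, hw₁⟩, hw₂⟩ := Whitney.mem_region.1 hw
    exact ⟨Whitney.pos_of_mem_region hz hw, by rw [add_mul]; exact (add_lt_add hw₂ hw₁).le⟩
  calc c.average u z ^ 2 = ⨍⁻ w in c.region z, ‖u w‖ₑ ^ 2 ∂volume := by
        rw [Whitney.average_sq, setLAverage_eq]
    _ ≤ C * ∫⁻ w in c.region z, weight (-n) w.1 * ‖u w‖ₑ ^ 2 ∂haarUpper n := h _ z hz
    _ ≤ C * ∫⁻ w in c.region z, k * weight (-n) z.1 * ‖u w‖ₑ ^ 2 ∂haarUpper n := by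
        gcongr 1
        refine setLIntegral_mono' (c.measurableSet_region z) fun w hw => ?_
        gcongr
        exact Whitney.weight_le_of_mem_region _ hw
    _ ≤ C * (k * weight (-n) z.1 * ∫⁻ w in tent z.2 (l * z.1), ‖u w‖ₑ ^ 2 ∂haarUpper n) := by
        have hz' := weight_ne_top (-(n : ℝ)) hz
        rw [lintegral_const_mul' _ _ (by finiteness)]
        gcongr
    _ ≤ C * (k * weight (-n) z.1 *
          (volume (ball z.2 (l * z.1)) * (weight α (l * z.1) * carleson α u) ^ 2)) := by
        gcongr
        exact carleson_le_iff.1 le_rfl _ _ (mul_pos hl hz)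
    _ = weight (-n) z.1 * weight n z.1 *
          (C * k * weight n l * V * weight α l ^ 2 * (weight α z.1 * carleson α u) ^ 2) := by
        rw [volume_ball _ (mul_pos hl hz), weight_mul _ hl, weight_mul _ hl]
        ring
    _ = C * k * weight n l * V * weight α l ^ 2 * (weight α z.1 * carleson α u) ^ 2 := by
        rw [weight_neg_mul_self _ hz, one_mul]

lemma coneIntegral_indicator_tent (φ : Space n → ℝ≥0∞) {x y : EuclideanSpace ℝ (Fin n)} {r : ℝ}
    (hy : y ∉ ball x r) : coneIntegral 1 ((tent x r).indicator φ) y = 0 := by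
  refine setLIntegral_eq_zero (measurableSet_wideCone 1 y) fun z hz => ?_
  have hzt : z ∉ tent x r := fun hzt => hy <| mem_ball.2 <|
    calc dist y x ≤ dist z.2 y + dist z.2 x := dist_triangle_left _ _ _
      _ < z.1 + dist z.2 x := by gcongr; exact hz.2.trans_eq (one_mul _)
      _ ≤ r := by rw [add_comm]; exact hzt.2
  simp [hzt]

lemma setLAverage_indicator_tent_le (u : Space n → F) (x y : EuclideanSpace ℝ (Fin n)) (r : ℝ)
    {t : ℝ} (ht : 0 < t) :
    ⨍⁻ w in bigWhitney.region (t, y), (tent x r).indicator (fun z => ‖u z‖ₑ ^ 2) w ∂volume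
      ≤ (Ioc 0 (2 * r)).indicator (fun t => bigWhitney.average u (t, y) ^ 2) t := by
  by_cases htr : t ≤ 2 * r
  · rw [indicator_of_mem (mem_Ioc.2 ⟨ht, htr⟩), Whitney.average_sq, setLAverage_eq]
    gcongr
    exact indicator_le_self _ _ _
  · have hzero : ∀ w ∈ bigWhitney.region (t, y),
        (tent x r).indicator (fun z => ‖u z‖ₑ ^ 2) w = 0 := fun w hw => by
      refine indicator_of_notMem (fun hwt => htr ?_) _
      have hle : w.1 ≤ r := (le_add_of_nonneg_left dist_nonneg).trans hwt.2
      exact (Whitney.lt_mul_of_mem_region hw).le.trans (mul_le_mul_of_nonneg_left hle zero_le_two)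
    rw [setLAverage_eq, setLIntegral_eq_zero (bigWhitney.measurableSet_region _) hzero]
    simp

lemma exists_setLIntegral_tent_le (n : ℕ) (F : Type*) [NormedAddCommGroup F] :
    ∃ C : ℝ≥0∞, C ≠ ∞ ∧ ∀ u : Space n → F, (Measurable fun z => ‖u z‖ₑ) →
      ∀ (x : EuclideanSpace ℝ (Fin n)) (r : ℝ),
        ∫⁻ z in tent x r, ‖u z‖ₑ ^ 2 ∂haarUpper n ≤ C * ∫⁻ y in ball x r,
          ∫⁻ t in Ioc 0 (2 * r), bigWhitney.average u (t, y) ^ 2 ∂haarIoi := by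
  obtain ⟨C, hC, h⟩ := exists_coneIntegral_le n
  set V := volume (ball (0 : EuclideanSpace ℝ (Fin n)) 1)
  have hV₀ : V ≠ 0 := (measure_ball_pos volume _ one_pos).ne'
  have hV : V ≠ ∞ := measure_ball_lt_top.ne
  refine ⟨V⁻¹ * C, by finiteness, fun u hu x r => ?_⟩
  set φ : Space n → ℝ≥0∞ := (tent x r).indicator fun z => ‖u z‖ₑ ^ 2
  have hφ : Measurable φ := (hu.pow_const 2).indicator (measurableSet_tent x r)
  have hball : ∫⁻ y, coneIntegral 1 φ y = ∫⁻ y in ball x r, coneIntegral 1 φ y := by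
    refine (setLIntegral_eq_of_support_subset fun y hy => ?_).symm
    exact not_not.1 fun hy' => hy (coneIntegral_indicator_tent _ hy')
  calc ∫⁻ z in tent x r, ‖u z‖ₑ ^ 2 ∂haarUpper n = V⁻¹ * ∫⁻ y, coneIntegral 1 φ y := by
        rw [lintegral_coneIntegral one_pos hφ, ← mul_assoc, ENNReal.inv_mul_cancel hV₀ hV, one_mul,
          lintegral_indicator (measurableSet_tent x r)]
    _ ≤ V⁻¹ * ∫⁻ y in ball x r,
          C * ∫⁻ t in Ioc 0 (2 * r), bigWhitney.average u (t, y) ^ 2 ∂haarIoi := by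
        rw [hball]
        gcongr with y
        refine (h φ hφ y).trans ?_
        rw [← lintegral_indicator measurableSet_Ioc]
        gcongr 1
        refine lintegral_mono_ae ?_
        filter_upwards [ae_haarIoi_pos] with t ht using setLAverage_indicator_tent_le u x y r ht
    _ = V⁻¹ * C * ∫⁻ y in ball x r,
          ∫⁻ t in Ioc 0 (2 * r), bigWhitney.average u (t, y) ^ 2 ∂haarIoi := by
        rw [lintegral_const_mul' _ _ hC, mul_assoc]

lemma exists_carleson_le (n : ℕ) (F : Type*) [NormedAddCommGroup F] (α : ℝ) :
    ∃ C : ℝ≥0∞, C ≠ ∞ ∧ ∀ u : Space n → F, (Measurable fun z => ‖u z‖ₑ) → ∀ K : ℝ≥0∞,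
      (∀ (x : EuclideanSpace ℝ (Fin n)) (r : ℝ), 0 < r → ∫⁻ y in ball x r, ∫⁻ t in Ioc 0 r,
        bigWhitney.average u (t, y) ^ 2 ∂haarIoi ≤ volume (ball x r) * (weight α r * K) ^ 2) →
      carleson α u ≤ C * K := by
  obtain ⟨C, hC, h⟩ := exists_setLIntegral_tent_le n F
  have h₂n := weight_ne_top n two_pos
  have h₂α := weight_ne_top α two_pos
  refine ⟨(C * weight n 2) ^ (1 / 2 : ℝ) * weight α 2, by finiteness,
    fun u hu K hK => carleson_le_iff.2 fun x r hr => ?_⟩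
  calc ∫⁻ z in tent x r, ‖u z‖ₑ ^ 2 ∂haarUpper n
      ≤ C * ∫⁻ y in ball x (2 * r),
          ∫⁻ t in Ioc 0 (2 * r), bigWhitney.average u (t, y) ^ 2 ∂haarIoi := by
        refine (h u hu x r).trans ?_
        gcongr
        linarith
    _ ≤ C * (volume (ball x (2 * r)) * (weight α (2 * r) * K) ^ 2) := by
        gcongr
        exact hK x (2 * r) (mul_pos two_pos hr)
    _ = volume (ball x r) *
          (weight α r * ((C * weight n 2) ^ (1 / 2 : ℝ) * weight α 2 * K)) ^ 2 := by
        rw [volume_ball x (mul_pos two_pos hr), volume_ball x hr, weight_mul _ two_pos,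
          weight_mul _ two_pos, mul_pow, mul_pow, mul_pow, mul_pow, mul_pow, rpow_half_sq]
        ring

lemma exists_carleson_le_of_average_le (n : ℕ) (F : Type*) [NormedAddCommGroup F] {α : ℝ}
    (hα : 0 < α) :
    ∃ C : ℝ≥0∞, C ≠ ∞ ∧ ∀ u : Space n → F, (Measurable fun z => ‖u z‖ₑ) → ∀ N : ℝ≥0∞,
      (∀ z : Space n, 0 < z.1 → bigWhitney.average u z ≤ weight α z.1 * N) →
        carleson α u ≤ C * N := by
  obtain ⟨C, hC, h⟩ := exists_carleson_le n F α
  set A := ENNReal.ofReal (2 * α)⁻¹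
  have hA : A ≠ ∞ := ENNReal.ofReal_ne_top
  refine ⟨C * A ^ (1 / 2 : ℝ), by finiteness, fun u hu N hN => ?_⟩
  rw [mul_assoc C]
  refine h u hu _ fun x r hr => ?_
  calc ∫⁻ y in ball x r, ∫⁻ t in Ioc 0 r, bigWhitney.average u (t, y) ^ 2 ∂haarIoi
      ≤ ∫⁻ _ in ball x r, ∫⁻ t in Ioc 0 r, weight (2 * α) t * N ^ 2 ∂haarIoi := by
        refine lintegral_mono fun y => setLIntegral_mono' measurableSet_Ioc fun t ht => ?_
        rw [← weight_sq, ← mul_pow]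
        gcongr
        exact hN (t, y) ht.1
    _ = volume (ball x r) * (A * weight (2 * α) r * N ^ 2) := by
        rw [setLIntegral_const, lintegral_mul_const _ (measurable_weight _),
          setLIntegral_Ioc_weight (by positivity) hr, mul_comm]
    _ = volume (ball x r) * (weight α r * (A ^ (1 / 2 : ℝ) * N)) ^ 2 := by
        rw [mul_pow, mul_pow, rpow_half_sq, weight_sq]
        ring

end Carleson

section LpNorm

variable {α : Type*} [MeasurableSpace α] {μ : Measure α} {p q : ℝ} {S : α → ℝ≥0∞}

lemma eLpNorm_ofReal_rpow (hp : 0 < p) (S : α → ℝ≥0∞) :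
    eLpNorm S (ENNReal.ofReal p) μ ^ p = ∫⁻ x, S x ^ p ∂μ := by
  rw [eLpNorm_eq_lintegral_rpow_enorm_toReal (ENNReal.ofReal_pos.2 hp).ne' ENNReal.ofReal_ne_top,
    ENNReal.toReal_ofReal hp.le, ← ENNReal.rpow_mul, one_div_mul_cancel hp.ne', ENNReal.rpow_one]
  simp only [enorm_eq_self]

lemma eLpNorm_rpow_mul_const_rpow (hp : 0 < p) (hpq : p ≤ q) (hS : Measurable S) :
    eLpNorm (fun x => S x ^ (p / q) * eLpNorm S (ENNReal.ofReal p) μ ^ (1 - p / q))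
      (ENNReal.ofReal q) μ = eLpNorm S (ENNReal.ofReal p) μ := by
  have hq : 0 < q := hp.trans_le hpq
  refine ENNReal.rpow_left_injective hq.ne' ?_
  calc eLpNorm _ (ENNReal.ofReal q) μ ^ q
      = ∫⁻ x, (S x ^ (p / q) * eLpNorm S (ENNReal.ofReal p) μ ^ (1 - p / q)) ^ q ∂μ :=
        eLpNorm_ofReal_rpow hq _
    _ = ∫⁻ x, S x ^ p * eLpNorm S (ENNReal.ofReal p) μ ^ (q - p) ∂μ := by
        refine lintegral_congr fun x => ?_
        rw [ENNReal.mul_rpow_of_nonneg _ _ hq.le, ← ENNReal.rpow_mul, ← ENNReal.rpow_mul,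
          div_mul_cancel₀ _ hq.ne', one_sub_mul, div_mul_cancel₀ _ hq.ne']
    _ = eLpNorm S (ENNReal.ofReal p) μ ^ q := by
        rw [lintegral_mul_const _ (hS.pow_const p), ← eLpNorm_ofReal_rpow hp,
          ← ENNReal.rpow_add_of_nonneg _ _ hp.le (sub_nonneg.2 hpq), add_sub_cancel]

lemma setLIntegral_rpow_le_eLpNorm {m : ℝ} (hm : 0 < m) (hmp : m ≤ p) (hS : Measurable S)
    (B : Set α) :
    ∫⁻ x in B, S x ^ m ∂μ ≤ μ B ^ (1 - m / p) * eLpNorm S (ENNReal.ofReal p) μ ^ m := by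
  have hp : 0 < p := hm.trans_le hmp
  have hmp' := eLpNorm_le_eLpNorm_mul_rpow_measure_univ (ENNReal.ofReal_le_ofReal hmp)
    (hS.aestronglyMeasurable (μ := μ.restrict B))
  rw [ENNReal.toReal_ofReal hm.le, ENNReal.toReal_ofReal hp.le, Measure.restrict_apply_univ]
    at hmp'
  calc ∫⁻ x in B, S x ^ m ∂μ = eLpNorm S (ENNReal.ofReal m) (μ.restrict B) ^ m :=
        (eLpNorm_ofReal_rpow hm S).symm
    _ ≤ (eLpNorm S (ENNReal.ofReal p) μ * μ B ^ (1 / m - 1 / p)) ^ m := by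
        gcongr
        exact hmp'.trans (by gcongr; exact Measure.restrict_le_self)
    _ = μ B ^ (1 - m / p) * eLpNorm S (ENNReal.ofReal p) μ ^ m := by
        rw [ENNReal.mul_rpow_of_nonneg _ _ hm.le, ← ENNReal.rpow_mul, mul_comm, sub_mul,
          one_div_mul_cancel hm.ne', one_div_mul_eq_div]

lemma eLpNorm_le_mul_of_ae_le {e C : ℝ≥0∞} {T : α → ℝ≥0∞} (hC : C ≠ ∞)
    (h : ∀ᵐ x ∂μ, S x ≤ C * T x) : eLpNorm S e μ ≤ C * eLpNorm T e μ := by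
  lift C to ℝ≥0 using hC
  exact eLpNorm_le_mul_eLpNorm_of_ae_le_mul' (by simpa only [enorm_eq_self] using h) e

lemma le_rpow_inv_mul_of_rpow_le {x y K : ℝ≥0∞} (hp : 0 < p) (h : x ^ p ≤ K * y ^ p) :
    x ≤ K ^ p⁻¹ * y := by
  rwa [← ENNReal.rpow_le_rpow_iff hp, ENNReal.mul_rpow_of_nonneg _ _ hp.le,
    ENNReal.rpow_inv_rpow hp.ne']

end LpNorm

section KenigPipher

variable {n : ℕ} {p q r : ℝ}

lemma le_nontangentialMax (u : Space n → ℝ≥0∞) {z : Space n} {y : EuclideanSpace ℝ (Fin n)}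
    (hz : z ∈ wideCone (1 / 4) y) : u z ≤ nontangentialMax u y :=
  le_iSup₂_of_le z hz le_rfl

lemma apply_le_nontangentialMax (u : Space n → ℝ≥0∞) (x : EuclideanSpace ℝ (Fin n)) {t : ℝ}
    (ht : 0 < t) : u (t, x) ≤ nontangentialMax u x :=
  le_nontangentialMax u ⟨ht, (dist_self x).trans_lt (by positivity)⟩

lemma exists_le_weight_mul_eLpNorm (n : ℕ) (hp : 0 < p) :
    ∃ C : ℝ≥0∞, C ≠ ∞ ∧ ∀ (u : Space n → ℝ≥0∞) (x : EuclideanSpace ℝ (Fin n)) (t : ℝ),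
      0 < t → u (t, x) ≤ weight (-(n / p)) t
        * (C * eLpNorm (nontangentialMax u) (ENNReal.ofReal p) volume) := by
  set κ := volume (ball (0 : EuclideanSpace ℝ (Fin n)) (1 / 4)) with hκ
  have hκ₀ : κ ≠ 0 := (measure_ball_pos volume _ (by norm_num)).ne'
  have hκ_top : κ ≠ ∞ := measure_ball_lt_top.ne
  refine ⟨κ⁻¹ ^ p⁻¹, by finiteness, fun u x t ht => ?_⟩
  have hball : volume (ball x (1 / 4 * t)) = weight n t * κ := by
    rw [hκ, volume_ball _ (by positivity), volume_ball (0) (r := 1 / 4) (by norm_num),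
      weight_mul _ (by norm_num), mul_left_comm, mul_assoc]
  have hbound : weight n t * κ * u (t, x) ^ p
      ≤ eLpNorm (nontangentialMax u) (ENNReal.ofReal p) volume ^ p := by
    calc weight n t * κ * u (t, x) ^ p = ∫⁻ _ in ball x (1 / 4 * t), u (t, x) ^ p := by
          rw [setLIntegral_const, hball, mul_comm]
      _ ≤ ∫⁻ y in ball x (1 / 4 * t), nontangentialMax u y ^ p := by
          refine setLIntegral_mono' measurableSet_ball fun y hy => ?_
          gcongr
          exact le_nontangentialMax u ⟨ht, mem_ball'.1 hy⟩
      _ ≤ ∫⁻ y, nontangentialMax u y ^ p := setLIntegral_le_lintegral _ _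
      _ = _ := (eLpNorm_ofReal_rpow hp _).symm
  rw [← ENNReal.rpow_le_rpow_iff hp, ENNReal.mul_rpow_of_nonneg _ _ hp.le,
    ENNReal.mul_rpow_of_nonneg _ _ hp.le, weight_rpow, neg_mul, div_mul_cancel₀ _ hp.ne',
    ENNReal.rpow_inv_rpow hp.ne']
  calc u (t, x) ^ p = weight (-n) t * weight n t * (κ⁻¹ * κ) * u (t, x) ^ p := by
        rw [weight_neg_mul_self _ ht, ENNReal.inv_mul_cancel hκ₀ hκ_top, one_mul, one_mul]
    _ = weight (-n) t * (κ⁻¹ * (weight n t * κ * u (t, x) ^ p)) := by ring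
    _ ≤ _ := by gcongr

lemma exists_lintegral_weight_mul_rpow_le (hn : 0 < n) (hp : 0 < p) (hpq : p < q) (hr : 0 < r) :
    ∃ C : ℝ≥0∞, C ≠ ∞ ∧ ∀ (u : Space n → ℝ≥0∞) (x : EuclideanSpace ℝ (Fin n)),
      ∫⁻ t, (weight (n / p - n / q) t * u (t, x)) ^ r ∂haarIoi
        ≤ C * (nontangentialMax u x ^ (p / q)
          * eLpNorm (nontangentialMax u) (ENNReal.ofReal p) volume ^ (1 - p / q)) ^ r := by
  have hn' : (0 : ℝ) < n := Nat.cast_pos.2 hn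
  have hq : 0 < q := hp.trans hpq
  have ha : 0 < n / p - n / q := sub_pos.2 (div_lt_div_of_pos_left hn' hp hpq)
  have hratio : 0 ≤ 1 - p / q := sub_nonneg.2 (div_le_one_of_le₀ hpq.le hq.le)
  have hratio₁ : n / q / (n / p - n / q + n / q) = p / q := by
    rw [sub_add_cancel]
    field_simp
  have hratio₂ : (n / p - n / q) / (n / p - n / q + n / q) = 1 - p / q := by
    rw [sub_add_cancel]
    field_simp
  obtain ⟨C₁, hC₁, h₁⟩ := exists_le_weight_mul_eLpNorm n hp
  obtain ⟨C₂, hC₂, h₂⟩ := exists_lintegral_rpow_le_of_le_weight ha (div_pos hn' hq) hr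
  refine ⟨C₂ * (C₁ ^ (1 - p / q)) ^ r, by finiteness, fun u x => ?_⟩
  set M := eLpNorm (nontangentialMax u) (ENNReal.ofReal p) volume
  calc ∫⁻ t, (weight (n / p - n / q) t * u (t, x)) ^ r ∂haarIoi
      ≤ C₂ * (nontangentialMax u x ^ (n / q / (n / p - n / q + n / q))
          * (C₁ * M) ^ ((n / p - n / q) / (n / p - n / q + n / q))) ^ r := by
        refine h₂ (fun t => weight (n / p - n / q) t * u (t, x)) _ _ (fun t ht => ?_) fun t ht => ?_
        · gcongr
          exact apply_le_nontangentialMax u x ht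
        · rw [← weight_mul_weight ht (by ring : n / p - n / q + -(n / p) = -(n / q)), mul_assoc]
          gcongr
          exact h₁ u x t ht
    _ = C₂ * (C₁ ^ (1 - p / q)) ^ r * (nontangentialMax u x ^ (p / q) * M ^ (1 - p / q)) ^ r := by
        rw [hratio₁, hratio₂, ENNReal.mul_rpow_of_nonneg _ _ hratio, mul_assoc,
          ← ENNReal.mul_rpow_of_nonneg _ _ hr.le, mul_left_comm]

lemma exists_setLIntegral_Ioc_weight_mul_sq_le {α m : ℝ} (hn : 0 < n) (hp : 0 < p) (hα : 0 ≤ α)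
    (hm : 0 < m) (hm₂ : m ≤ 2) :
    ∃ C : ℝ≥0∞, C ≠ ∞ ∧ ∀ (u : Space n → ℝ≥0∞) (x : EuclideanSpace ℝ (Fin n)) (r : ℝ), 0 < r →
      ∫⁻ t in Ioc 0 r, (weight (n / p + α) t * u (t, x)) ^ 2 ∂haarIoi
        ≤ C * weight (m * (n / p) + 2 * α) r
          * eLpNorm (nontangentialMax u) (ENNReal.ofReal p) volume ^ (2 - m)
          * nontangentialMax u x ^ m := by
  have hm' : 0 ≤ 2 - m := sub_nonneg.2 hm₂
  have hexp : 0 < m * (n / p) + 2 * α := by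
    have : (0 : ℝ) < n := Nat.cast_pos.2 hn
    positivity
  obtain ⟨C, hC, h⟩ := exists_le_weight_mul_eLpNorm n hp
  refine ⟨ENNReal.ofReal (m * (n / p) + 2 * α)⁻¹ * C ^ (2 - m), by finiteness, fun u x r hr => ?_⟩
  set M := eLpNorm (nontangentialMax u) (ENNReal.ofReal p) volume
  have hu (t : ℝ) (ht : 0 < t) : (weight (n / p + α) t * u (t, x)) ^ 2
      ≤ weight (m * (n / p) + 2 * α) t * ((C * M) ^ (2 - m) * nontangentialMax u x ^ m) := by
    calc (weight (n / p + α) t * u (t, x)) ^ 2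
        = weight (2 * (n / p + α)) t * (u (t, x) ^ (2 - m) * u (t, x) ^ m) := by
          rw [mul_pow, weight_sq, ← ENNReal.rpow_add_of_nonneg _ _ hm' hm.le, sub_add_cancel,
            ENNReal.rpow_two]
      _ ≤ weight (2 * (n / p + α)) t
            * ((weight (-(n / p)) t * (C * M)) ^ (2 - m) * nontangentialMax u x ^ m) := by
          gcongr
          · exact h u x t ht
          · exact apply_le_nontangentialMax u x ht
      _ = weight (m * (n / p) + 2 * α) t * ((C * M) ^ (2 - m) * nontangentialMax u x ^ m) := by
          rw [ENNReal.mul_rpow_of_nonneg _ _ hm', weight_rpow, mul_assoc, ← mul_assoc,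
            weight_mul_weight ht
              (by ring : 2 * (n / p + α) + -(n / p) * (2 - m) = m * (n / p) + 2 * α)]
  calc ∫⁻ t in Ioc 0 r, (weight (n / p + α) t * u (t, x)) ^ 2 ∂haarIoi
      ≤ ∫⁻ t in Ioc 0 r, weight (m * (n / p) + 2 * α) t
          * ((C * M) ^ (2 - m) * nontangentialMax u x ^ m) ∂haarIoi :=
        setLIntegral_mono' measurableSet_Ioc fun t ht => hu t ht.1
    _ = _ := by
        rw [lintegral_mul_const _ (measurable_weight _), setLIntegral_Ioc_weight hexp hr,
          ENNReal.mul_rpow_of_nonneg _ _ hm']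
        ring

lemma exists_setLIntegral_box_le {α : ℝ} (hn : 0 < n) (hp : 0 < p) (hα : 0 ≤ α) :
    ∃ C : ℝ≥0∞, C ≠ ∞ ∧ ∀ (u : Space n → ℝ≥0∞) (x : EuclideanSpace ℝ (Fin n)) (r : ℝ), 0 < r →
      ∫⁻ y in ball x r, ∫⁻ t in Ioc 0 r, (weight (n / p + α) t * u (t, y)) ^ 2 ∂haarIoi
        ≤ volume (ball x r) * (weight α r
          * (C * eLpNorm (nontangentialMax u) (ENNReal.ofReal p) volume)) ^ 2 := by
  set m := min 2 p
  have hm : 0 < m := lt_min two_pos hp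
  have hm₂ : m ≤ 2 := min_le_left _ _
  obtain ⟨C, hC, h⟩ := exists_setLIntegral_Ioc_weight_mul_sq_le hn hp hα hm hm₂
  set V := volume (ball (0 : EuclideanSpace ℝ (Fin n)) 1)
  have hV₀ : V ≠ 0 := (measure_ball_pos volume _ one_pos).ne'
  have hV : V ≠ ∞ := measure_ball_lt_top.ne
  refine ⟨(C * V ^ (-(m / p))) ^ (1 / 2 : ℝ), by finiteness, fun u x r hr => ?_⟩
  set M := eLpNorm (nontangentialMax u) (ENNReal.ofReal p) volume
  have hB₀ : volume (ball x r) ≠ 0 := (measure_ball_pos volume x hr).ne'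
  have hB : volume (ball x r) ≠ ∞ := measure_ball_lt_top.ne
  have hM : M ^ (2 - m) * M ^ m = M ^ 2 := by
    rw [← ENNReal.rpow_add_of_nonneg _ _ (sub_nonneg.2 hm₂) hm.le, sub_add_cancel, ENNReal.rpow_two]
  have hsplit : volume (ball x r) ^ (1 - m / p)
      = volume (ball x r) * (weight (-(n * (m / p))) r * V ^ (-(m / p))) := by
    rw [sub_eq_add_neg, ENNReal.rpow_add _ _ hB₀ hB, ENNReal.rpow_one]
    congr 1
    rw [volume_ball x hr, ENNReal.mul_rpow_of_ne_top (weight_ne_top _ hr) hV, weight_rpow,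
      mul_neg]
  calc ∫⁻ y in ball x r, ∫⁻ t in Ioc 0 r, (weight (n / p + α) t * u (t, y)) ^ 2 ∂haarIoi
      ≤ ∫⁻ y in ball x r,
          C * weight (m * (n / p) + 2 * α) r * M ^ (2 - m) * nontangentialMax u y ^ m :=
        lintegral_mono fun y => h u y r hr
    _ = C * weight (m * (n / p) + 2 * α) r * M ^ (2 - m)
          * ∫⁻ y in ball x r, nontangentialMax u y ^ m :=
        lintegral_const_mul _ ((measurable_nontangentialMax u).pow_const m)
    _ ≤ C * weight (m * (n / p) + 2 * α) r * M ^ (2 - m)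
          * (volume (ball x r) ^ (1 - m / p) * M ^ m) := by
        gcongr
        exact setLIntegral_rpow_le_eLpNorm hm (min_le_right _ _) (measurable_nontangentialMax u) _
    _ = volume (ball x r) * (weight α r * ((C * V ^ (-(m / p))) ^ (1 / 2 : ℝ) * M)) ^ 2 := by
        rw [hsplit, mul_pow, mul_pow, rpow_half_sq, weight_sq, ← hM,
          ← weight_mul_weight hr (by ring : m * (n / p) + 2 * α + -(n * (m / p)) = 2 * α)]
        ring

lemma exists_eLpNorm_weight_mul_le (hn : 0 < n) (hp : 0 < p) (hpq : p < q) :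
    ∃ C : ℝ≥0∞, C ≠ ∞ ∧ ∀ u : Space n → ℝ≥0∞, Measurable u →
      eLpNorm (fun z => weight (n / p - n / q) z.1 * u z) (ENNReal.ofReal q) (haarUpper n)
        ≤ C * eLpNorm (nontangentialMax u) (ENNReal.ofReal p) volume := by
  have hq : 0 < q := hp.trans hpq
  obtain ⟨C, hC, h⟩ := exists_lintegral_weight_mul_rpow_le hn hp hpq hq
  refine ⟨C ^ q⁻¹, by finiteness, fun u hu => le_rpow_inv_mul_of_rpow_le hq ?_⟩
  set M := eLpNorm (nontangentialMax u) (ENNReal.ofReal p) volume with hM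
  calc eLpNorm (fun z => weight (n / p - n / q) z.1 * u z) (ENNReal.ofReal q) (haarUpper n) ^ q
      = ∫⁻ x, ∫⁻ t, (weight (n / p - n / q) t * u (t, x)) ^ q ∂haarIoi := by
        rw [eLpNorm_ofReal_rpow hq, haarUpper_eq_prod]
        exact lintegral_prod_symm _ ((measurable_weight_fst_mul _ hu).pow_const q).aemeasurable
    _ ≤ ∫⁻ x, C * (nontangentialMax u x ^ (p / q) * M ^ (1 - p / q)) ^ q :=
        lintegral_mono fun x => h u x
    _ = C * M ^ q := by
        rw [lintegral_const_mul' _ _ hC, ← eLpNorm_ofReal_rpow hq, hM,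
          eLpNorm_rpow_mul_const_rpow hp hpq.le (measurable_nontangentialMax u)]

end KenigPipher

section Kappa

variable {n : ℕ} {F : Type*} [NormedAddCommGroup F] [NormedSpace ℝ F]

lemma enorm_kappa (a : ℝ) (f : Space n → F) {z : Space n} (hz : 0 < z.1) :
    ‖kappa a f z‖ₑ = weight a z.1 * ‖f z‖ₑ := by
  rw [kappa, enorm_smul, Real.enorm_of_nonneg (Real.rpow_nonneg hz.le _), weight_eq_ofReal a hz]

lemma measurable_enorm_kappa (a : ℝ) (f : L0 n F) : Measurable fun z => ‖kappa a f z‖ₑ := by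
  simp only [kappa, enorm_smul]
  exact (measurable_fst.pow_const a).enorm.mul f.stronglyMeasurable.enorm

lemma Whitney.exists_average_kappa_le (c : Whitney) (n : ℕ) (F : Type*) [NormedAddCommGroup F]
    [NormedSpace ℝ F] {a b e : ℝ} (h : a = e + b) :
    ∃ C : ℝ≥0∞, C ≠ ∞ ∧ ∀ (f : Space n → F) (z : Space n), 0 < z.1 →
      c.average (kappa a f) z ≤ C * (weight e z.1 * c.average (kappa b f) z) := by
  have hC := weight_ne_top |e| c.c₁_pos
  refine ⟨weight |e| c.c₁, hC, fun f z hz => ?_⟩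
  have he := weight_ne_top e hz
  rw [← mul_assoc]
  refine average_le_mul (by finiteness) fun w hw => ?_
  have hw₀ := pos_of_mem_region hz hw
  rw [enorm_kappa a f hw₀, enorm_kappa b f hw₀, ← weight_mul_weight hw₀ h.symm, mul_assoc]
  gcongr
  exact weight_le_of_mem_region e hw

end Kappa

section Controls

variable {n : ℕ} {F : Type*} [NormedAddCommGroup F]

/-- `N₁ ≲ N₀`: for quasi-norms on `L⁰` taking the value `∞` off their spaces, this says that the
space of `N₀` embeds continuously into the space of `N₁`. -/
def Controls (N₀ N₁ : L0 n F → ℝ≥0∞) : Prop :=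
  ∃ C : ℝ≥0∞, C ≠ ∞ ∧ ∀ f, N₁ f ≤ C * N₀ f

lemma Controls.trans {N₀ N₁ N₂ : L0 n F → ℝ≥0∞} (h : Controls N₀ N₁) (h' : Controls N₁ N₂) :
    Controls N₀ N₂ := by
  obtain ⟨C, hC, h⟩ := h
  obtain ⟨C', hC', h'⟩ := h'
  refine ⟨C' * C, by finiteness, fun f => (h' f).trans ?_⟩
  rw [mul_assoc]
  gcongr
  exact h f

variable [NormedSpace ℝ F] {p q s s' α α' : ℝ}

/-- The Kenig–Pipher quasi-norm `‖𝓝(𝓦_c(t^{-s} f))‖_{L^p(ℝⁿ)}`, where `𝓝` is the nontangential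
maximal function. The embeddings of spaces with a finite exponent factor through it. -/
def kenigPipherNorm (c : Whitney) (p s : ℝ) (f : L0 n F) : ℝ≥0∞ :=
  eLpNorm (nontangentialMax (c.average (kappa (-s) f))) (ENNReal.ofReal p) volume

lemma controls_tent_kenigPipher (c : Whitney) (hp : 0 < p) :
    Controls (n := n) (F := F) (Scale.T.qnorm c (.finite p s hp))
      (kenigPipherNorm smallWhitney p s) := by
  obtain ⟨C, hC, h⟩ := exists_nontangentialMax_le_conical n F
  exact ⟨C, hC, fun f => eLpNorm_le_mul_of_ae_le hC (.of_forall fun y => h _ y)⟩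

lemma controls_z_kenigPipher (c d : Whitney) (hp : 0 < p) :
    Controls (n := n) (F := F) (Scale.Z.qnorm c (.finite p s hp)) (kenigPipherNorm d p s) := by
  obtain ⟨a, ha, C, hC, h⟩ := exists_nontangentialMax_rpow_le n F c d hp
  set V := volume (ball (0 : EuclideanSpace ℝ (Fin n)) a)
  have hV : V ≠ ∞ := measure_ball_lt_top.ne
  refine ⟨(C * V) ^ p⁻¹, by finiteness, fun f => le_rpow_inv_mul_of_rpow_le hp ?_⟩
  have hf := measurable_enorm_kappa (-s) f
  set u := c.average (kappa (-s) f)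
  calc kenigPipherNorm d p s f ^ p
      = ∫⁻ y, nontangentialMax (d.average (kappa (-s) f)) y ^ p := eLpNorm_ofReal_rpow hp _
    _ ≤ ∫⁻ y, C * coneIntegral a (fun z => u z ^ p) y := lintegral_mono fun y => h _ hf y
    _ = C * V * ∫⁻ z, u z ^ p ∂haarUpper n := by
        rw [lintegral_const_mul' _ _ hC,
          lintegral_coneIntegral ha ((c.measurable_average hf).pow_const p), mul_assoc]
    _ = C * V * Scale.Z.qnorm c (.finite p s hp) f ^ p := by
        rw [← eLpNorm_ofReal_rpow hp]
        rfl

lemma controls_kenigPipher_z_finite (d : Whitney) (hn : 0 < n) (hp : 0 < p) (hq : 0 < q)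
    (hpq : p < q) (hs : s - n / p = s' - n / q) :
    Controls (n := n) (F := F) (kenigPipherNorm d p s) (Scale.Z.qnorm d (.finite q s' hq)) := by
  obtain ⟨C₁, hC₁, h₁⟩ := d.exists_average_kappa_le n F
    (by linear_combination hs : -s' = (n / p - n / q) + -s)
  obtain ⟨C₂, hC₂, h₂⟩ := exists_eLpNorm_weight_mul_le hn hp hpq
  refine ⟨C₁ * C₂, by finiteness, fun f => ?_⟩
  calc Scale.Z.qnorm d (.finite q s' hq) f
      ≤ C₁ * eLpNorm (fun z => weight (n / p - n / q) z.1 * d.average (kappa (-s) f) z)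
          (ENNReal.ofReal q) (haarUpper n) :=
        eLpNorm_le_mul_of_ae_le hC₁ (ae_haarUpper_pos.mono fun z hz => h₁ f z hz)
    _ ≤ C₁ * (C₂ * kenigPipherNorm d p s f) := by
        gcongr
        exact h₂ _ (d.measurable_average (measurable_enorm_kappa (-s) f))
    _ = C₁ * C₂ * kenigPipherNorm d p s f := (mul_assoc _ _ _).symm

lemma controls_kenigPipher_tent_finite (d : Whitney) (hn : 0 < n) (hp : 0 < p) (hq : 0 < q)
    (hpq : p < q) (hs : s - n / p = s' - n / q) :
    Controls (n := n) (F := F) (kenigPipherNorm bigWhitney p s)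
      (Scale.T.qnorm d (.finite q s' hq)) := by
  obtain ⟨C₁, hC₁, h₁⟩ := bigWhitney.exists_average_kappa_le n F
    (by linear_combination hs : -s' = (n / p - n / q) + -s)
  obtain ⟨C₂, hC₂, h₂⟩ := exists_conical_sq_le n F
  obtain ⟨C₃, hC₃, h₃⟩ := exists_lintegral_weight_mul_rpow_le hn hp hpq two_pos
  have hC : (C₂ * (C₁ ^ 2 * C₃)) ^ (1 / 2 : ℝ) ≠ ∞ := by finiteness
  refine ⟨_, hC, fun f => ?_⟩
  set u := bigWhitney.average (kappa (-s) f)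
  set M := kenigPipherNorm bigWhitney p s f with hM
  have hconical (x : EuclideanSpace ℝ (Fin n)) : conical (kappa (-s') f) x
      ≤ (C₂ * (C₁ ^ 2 * C₃)) ^ (1 / 2 : ℝ)
        * (nontangentialMax u x ^ (p / q) * M ^ (1 - p / q)) := by
    refine le_rpow_half_mul_of_sq_le ?_
    calc conical (kappa (-s') f) x ^ 2
        ≤ C₂ * ∫⁻ t, bigWhitney.average (kappa (-s') f) (t, x) ^ 2 ∂haarIoi :=
          h₂ _ (measurable_enorm_kappa (-s') f) x
      _ ≤ C₂ * ∫⁻ t, C₁ ^ 2 * (weight (n / p - n / q) t * u (t, x)) ^ (2 : ℝ) ∂haarIoi := by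
          gcongr C₂ * ?_
          refine lintegral_mono_ae (ae_haarIoi_pos.mono fun t ht => ?_)
          rw [ENNReal.rpow_two, ← mul_pow]
          gcongr
          exact h₁ f (t, x) ht
      _ ≤ C₂ * (C₁ ^ 2
            * (C₃ * (nontangentialMax u x ^ (p / q) * M ^ (1 - p / q)) ^ (2 : ℝ))) := by
          rw [lintegral_const_mul' _ _ (ENNReal.pow_ne_top hC₁)]
          gcongr
          exact h₃ u x
      _ = C₂ * (C₁ ^ 2 * C₃) * (nontangentialMax u x ^ (p / q) * M ^ (1 - p / q)) ^ 2 := by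
          rw [ENNReal.rpow_two]
          ring
  refine (eLpNorm_le_mul_of_ae_le hC (.of_forall hconical)).trans_eq ?_
  rw [hM, kenigPipherNorm, eLpNorm_rpow_mul_const_rpow hp hpq.le (measurable_nontangentialMax u)]

lemma controls_kenigPipher_z_infinite (d : Whitney) (hp : 0 < p) (hα : 0 ≤ α)
    (hs : s - n / p = s' + α) :
    Controls (n := n) (F := F) (kenigPipherNorm d p s) (Scale.Z.qnorm d (.infinite s' α hα)) := by
  obtain ⟨C₁, hC₁, h₁⟩ := d.exists_average_kappa_le n F
    (by linear_combination hs : -(s' + α) = n / p + -s)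
  obtain ⟨C₂, hC₂, h₂⟩ := exists_le_weight_mul_eLpNorm n hp
  refine ⟨C₁ * C₂, by finiteness, fun f =>
    essSup_le_of_ae_le _ (ae_haarUpper_pos.mono fun z hz => ?_)⟩
  calc d.average (kappa (-(s' + α)) f) z
      ≤ C₁ * (weight (n / p) z.1 * d.average (kappa (-s) f) z) := h₁ f z hz
    _ ≤ C₁ * (weight (n / p) z.1 * (weight (-(n / p)) z.1 * (C₂ * kenigPipherNorm d p s f))) := by
        gcongr
        exact h₂ _ z.2 z.1 hz
    _ = C₁ * C₂ * kenigPipherNorm d p s f := by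
        rw [← mul_assoc (weight _ _), mul_comm (weight _ _), weight_neg_mul_self _ hz, one_mul,
          mul_assoc]

lemma controls_kenigPipher_tent_infinite (d : Whitney) (hn : 0 < n) (hp : 0 < p) (hα : 0 ≤ α)
    (hs : s - n / p = s' + α) :
    Controls (n := n) (F := F) (kenigPipherNorm bigWhitney p s)
      (Scale.T.qnorm d (.infinite s' α hα)) := by
  obtain ⟨C₁, hC₁, h₁⟩ := bigWhitney.exists_average_kappa_le n F
    (by linear_combination hs : -s' = (n / p + α) + -s)
  obtain ⟨C₂, hC₂, h₂⟩ := exists_setLIntegral_box_le hn hp hα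
  obtain ⟨C₃, hC₃, h₃⟩ := exists_carleson_le n F α
  refine ⟨C₃ * (C₁ * C₂), by finiteness, fun f => ?_⟩
  rw [mul_assoc C₃]
  refine h₃ _ (measurable_enorm_kappa (-s') f) _ fun x r hr => ?_
  set u := bigWhitney.average (kappa (-s) f)
  calc ∫⁻ y in ball x r, ∫⁻ t in Ioc 0 r, bigWhitney.average (kappa (-s') f) (t, y) ^ 2 ∂haarIoi
      ≤ ∫⁻ y in ball x r, C₁ ^ 2
          * ∫⁻ t in Ioc 0 r, (weight (n / p + α) t * u (t, y)) ^ 2 ∂haarIoi := by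
        refine lintegral_mono fun y => ?_
        rw [← lintegral_const_mul' _ _ (ENNReal.pow_ne_top hC₁)]
        refine setLIntegral_mono' measurableSet_Ioc fun t ht => ?_
        rw [← mul_pow]
        gcongr
        exact h₁ f (t, y) ht.1
    _ ≤ C₁ ^ 2 * (volume (ball x r)
          * (weight α r * (C₂ * kenigPipherNorm bigWhitney p s f)) ^ 2) := by
        rw [lintegral_const_mul' _ _ (ENNReal.pow_ne_top hC₁)]
        gcongr
        exact h₂ u x r hr
    _ = volume (ball x r)
          * (weight α r * (C₁ * C₂ * kenigPipherNorm bigWhitney p s f)) ^ 2 := by ring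

lemma controls_z_infinite_z_infinite (c d : Whitney) (hα : 0 ≤ α) (hα' : 0 ≤ α')
    (hs : s + α = s' + α') :
    Controls (n := n) (F := F) (Scale.Z.qnorm c (.infinite s α hα))
      (Scale.Z.qnorm d (.infinite s' α' hα')) := by
  obtain ⟨C, hC, h⟩ := Whitney.exists_average_le_eLpNorm_top n F c d
  refine ⟨C, hC, fun f => essSup_le_of_ae_le _ (ae_haarUpper_pos.mono fun z hz => ?_)⟩
  change d.average (kappa (-(s' + α')) f) z
    ≤ C * eLpNorm (c.average (kappa (-(s + α)) f)) ∞ (haarUpper n)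
  rw [hs]
  exact h _ z hz

lemma controls_tent_infinite_z_infinite (c d : Whitney) (hα : 0 ≤ α) (hα' : 0 ≤ α')
    (hs : s + α = s' + α') :
    Controls (n := n) (F := F) (Scale.T.qnorm c (.infinite s α hα))
      (Scale.Z.qnorm d (.infinite s' α' hα')) := by
  obtain ⟨C₁, hC₁, h₁⟩ := d.exists_average_kappa_le n F
    (by linear_combination hs : -(s' + α') = -α + -s)
  obtain ⟨C₂, hC₂, h₂⟩ := exists_average_le_carleson d n F α
  refine ⟨C₁ * C₂, by finiteness, fun f =>
    essSup_le_of_ae_le _ (ae_haarUpper_pos.mono fun z hz => ?_)⟩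
  calc d.average (kappa (-(s' + α')) f) z
      ≤ C₁ * (weight (-α) z.1 * d.average (kappa (-s) f) z) := h₁ f z hz
    _ ≤ C₁ * (weight (-α) z.1 * (C₂ * (weight α z.1 * carleson α (kappa (-s) f)))) := by
        gcongr
        exact h₂ _ z hz
    _ = C₁ * C₂ * (weight (-α) z.1 * weight α z.1 * carleson α (kappa (-s) f)) := by ring
    _ = C₁ * C₂ * carleson α (kappa (-s) f) := by rw [weight_neg_mul_self _ hz, one_mul]

lemma controls_z_infinite_tent_infinite (c d : Whitney) (hα : 0 ≤ α) (hα' : 0 < α')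
    (hs : s + α = s' + α') :
    Controls (n := n) (F := F) (Scale.Z.qnorm c (.infinite s α hα))
      (Scale.T.qnorm d (.infinite s' α' hα'.le)) := by
  obtain ⟨C₁, hC₁, h₁⟩ := bigWhitney.exists_average_kappa_le n F
    (by linear_combination hs : -s' = α' + -(s + α))
  obtain ⟨C₂, hC₂, h₂⟩ := Whitney.exists_average_le_eLpNorm_top n F c bigWhitney
  obtain ⟨C₃, hC₃, h₃⟩ := exists_carleson_le_of_average_le n F hα'
  refine ⟨C₃ * (C₁ * C₂), by finiteness, fun f => ?_⟩
  rw [mul_assoc C₃]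
  refine h₃ _ (measurable_enorm_kappa (-s') f) _ fun z hz => ?_
  calc bigWhitney.average (kappa (-s') f) z
      ≤ C₁ * (weight α' z.1 * bigWhitney.average (kappa (-(s + α)) f) z) := h₁ f z hz
    _ ≤ C₁ * (weight α' z.1 * (C₂ * Scale.Z.qnorm c (.infinite s α hα) f)) := by
        gcongr
        exact h₂ _ z hz
    _ = weight α' z.1 * (C₁ * C₂ * Scale.Z.qnorm c (.infinite s α hα) f) := by ring

end Controls

namespace Exponent

variable {n : ℕ} {p q s s' α α' : ℝ}

lemma embeds_finite_finite_iff (hn : 0 < n) (hp : 0 < p) (hq : 0 < q) :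
    (finite p s hp).Embeds n (finite q s' hq) ↔ s - n / p = s' - n / q ∧ p ≤ q := by
  have hn' : (0 : ℝ) < n := Nat.cast_pos.2 hn
  have hle : n / q ≤ n / p ↔ p ≤ q := div_le_div_iff_of_pos_left hn' hq hp
  simp only [Embeds, θ, j, mul_sub, mul_one_div]
  rw [← hle]
  exact ⟨fun ⟨h, h'⟩ => ⟨by linear_combination h, by linarith only [h, h']⟩,
    fun ⟨h, h'⟩ => ⟨by linear_combination h, by linarith only [h, h']⟩⟩

lemma embeds_finite_infinite_iff (hn : 0 < n) (hp : 0 < p) (hα : 0 ≤ α) :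
    (finite p s hp).Embeds n (infinite s' α hα) ↔ s - n / p = s' + α := by
  have hn' : (n : ℝ) ≠ 0 := Nat.cast_ne_zero.2 hn.ne'
  have hp' : 0 ≤ n / p := by positivity
  simp only [Embeds, θ, j, mul_sub, mul_one_div, mul_div_cancel₀ _ hn']
  exact ⟨fun ⟨h, _⟩ => by linear_combination h,
    fun h => ⟨by linear_combination h, by linarith only [h, hp', hα]⟩⟩

lemma not_embeds_infinite_finite (hn : 0 < n) (hα : 0 ≤ α) (hq : 0 < q) :
    ¬ (infinite s α hα).Embeds n (finite q s' hq) := by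
  have hn' : (0 : ℝ) < n := Nat.cast_pos.2 hn
  have hq' : 0 < n / q := by positivity
  simp only [Embeds, θ, j, mul_sub, mul_one_div, mul_div_cancel₀ _ hn'.ne']
  rintro ⟨h, h'⟩
  linarith only [h, h', hα, hq']

lemma embeds_infinite_infinite_iff (hn : 0 < n) (hα : 0 ≤ α) (hα' : 0 ≤ α') :
    (infinite s α hα).Embeds n (infinite s' α' hα') ↔ s + α = s' + α' ∧ α ≤ α' := by
  have hn' : (n : ℝ) ≠ 0 := Nat.cast_ne_zero.2 hn.ne'
  simp only [Embeds, θ, j, mul_sub, mul_div_cancel₀ _ hn']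
  exact ⟨fun ⟨h, h'⟩ => ⟨by linear_combination h, by linarith only [h, h']⟩,
    fun ⟨h, h'⟩ => ⟨by linear_combination h, by linarith only [h, h']⟩⟩

lemma Embeds.lt_of_ne {hp : 0 < p} {hq : 0 < q} (hn : 0 < n)
    (h : (finite p s hp).Embeds n (finite q s' hq)) (hne : finite p s hp ≠ finite q s' hq) :
    p < q := by
  obtain ⟨hs, hle⟩ := (embeds_finite_finite_iff hn hp hq).1 h
  refine hle.lt_of_ne ?_
  rintro rfl
  exact hne (by rw [sub_left_injective hs])

lemma Embeds.exists_intermediate {hp : 0 < p} {q : Exponent} (hn : 0 < n)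
    (h : (finite p s hp).Embeds n q) (hne : finite p s hp ≠ q) :
    ∃ (m t : ℝ) (hm : 0 < m), p < m ∧ s - n / p = t - n / m ∧
      (finite m t hm).Embeds n q ∧ finite m t hm ≠ q := by
  cases q with
  | finite q s' hq =>
    have hlt := h.lt_of_ne hn hne
    have hs := ((embeds_finite_finite_iff hn hp hq).1 h).1
    have hm : 0 < (p + q) / 2 := by positivity
    refine ⟨(p + q) / 2, s - n / p + n / ((p + q) / 2), hm, by linarith, by ring,
      (embeds_finite_finite_iff hn hm hq).2 ⟨by linarith, by linarith⟩, fun heq => ?_⟩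
    injection heq
    linarith
  | infinite s' α hα =>
    have hs := (embeds_finite_infinite_iff hn hp hα).1 h
    have hm : 0 < p + 1 := by positivity
    exact ⟨p + 1, s - n / p + n / (p + 1), hm, by linarith, by ring,
      (embeds_finite_infinite_iff hn hm hα).2 (by linarith), Exponent.noConfusion⟩

end Exponent

section MixedEmbedding

variable {n : ℕ} {F : Type*} [NormedAddCommGroup F] [NormedSpace ℝ F] {q : Exponent}

lemma exists_controls_kenigPipher (F : Type*) [NormedAddCommGroup F] [NormedSpace ℝ F]
    (hn : 0 < n) {r s : ℝ} {hr : 0 < r} (X : Scale) (d : Whitney)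
    (hq : (Exponent.finite r s hr).Embeds n q) (hne : Exponent.finite r s hr ≠ q) :
    ∃ e : Whitney, Controls (n := n) (F := F) (kenigPipherNorm e r s) (X.qnorm d q) := by
  cases q with
  | finite q s' hq' =>
    have hlt := hq.lt_of_ne hn hne
    have hs := ((Exponent.embeds_finite_finite_iff hn hr hq').1 hq).1
    cases X with
    | T => exact ⟨bigWhitney, controls_kenigPipher_tent_finite d hn hr hq' hlt hs⟩
    | Z => exact ⟨d, controls_kenigPipher_z_finite d hn hr hq' hlt hs⟩
  | infinite s' α hα =>
    have hs := (Exponent.embeds_finite_infinite_iff hn hr hα).1 hq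
    cases X with
    | T => exact ⟨bigWhitney, controls_kenigPipher_tent_infinite d hn hr hα hs⟩
    | Z => exact ⟨d, controls_kenigPipher_z_infinite d hr hα hs⟩

lemma controls_of_embeds_finite (hn : 0 < n) {r s : ℝ} {hr : 0 < r} (X₀ X₁ : Scale)
    (c d : Whitney) (hq : (Exponent.finite r s hr).Embeds n q)
    (hne : Exponent.finite r s hr ≠ q) :
    Controls (n := n) (F := F) (X₀.qnorm c (.finite r s hr)) (X₁.qnorm d q) := by
  cases X₀ with
  | Z =>
    obtain ⟨e, he⟩ := exists_controls_kenigPipher F hn X₁ d hq hne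
    exact (controls_z_kenigPipher c e hr).trans he
  | T =>
    -- The square function only controls Whitney averages over small regions; passing through a
    -- `Z`-space of intermediate exponent makes room to change the Whitney parameter.
    obtain ⟨m, t, hm, hrm, ht, hmq, hmne⟩ := hq.exists_intermediate hn hne
    obtain ⟨e, he⟩ := exists_controls_kenigPipher F hn X₁ d hmq hmne
    exact (((controls_tent_kenigPipher c hr).trans
      (controls_kenigPipher_z_finite smallWhitney hn hr hm hrm ht)).trans
        (controls_z_kenigPipher smallWhitney e hm)).trans he

lemma controls_of_embeds_infinite (hn : 0 < n) {s α : ℝ} {hα : 0 ≤ α} (X₀ X₁ : Scale)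
    (c d : Whitney) (hq : (Exponent.infinite s α hα).Embeds n q)
    (hne : Exponent.infinite s α hα ≠ q) :
    Controls (n := n) (F := F) (X₀.qnorm c (.infinite s α hα)) (X₁.qnorm d q) := by
  cases q with
  | finite q s' hq' => exact absurd hq (Exponent.not_embeds_infinite_finite hn hα hq')
  | infinite s' α' hα' =>
    obtain ⟨hs, hle⟩ := (Exponent.embeds_infinite_infinite_iff hn hα hα').1 hq
    have hlt : α < α' := hle.lt_of_ne <| by
      rintro rfl
      exact hne (by rw [add_right_cancel hs])
    have hz : Controls (n := n) (F := F) (X₀.qnorm c (.infinite s α hα))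
        (Scale.Z.qnorm d (.infinite s' α' hα')) := by
      cases X₀ with
      | T => exact controls_tent_infinite_z_infinite c d hα hα' hs
      | Z => exact controls_z_infinite_z_infinite c d hα hα' hs
    cases X₁ with
    | T => exact hz.trans (controls_z_infinite_tent_infinite d d hα' (hα.trans_lt hlt) rfl)
    | Z => exact hz

end MixedEmbedding

end

end FractionalData

theorem theorem2p34 (n : ℕ) (hn : 1 ≤ n)
    (F : Type*) [NormedAddCommGroup F] [NormedSpace ℝ F]
    (X₀ X₁ : FractionalData.Scale) (c d : FractionalData.Whitney)
    (p q : FractionalData.Exponent) (hpq : p.Embeds n q) (hne : p ≠ q) :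
    X₀.space n F c p ⊆ X₁.space n F d q ∧
      ∃ C : ℝ≥0, ∀ f ∈ X₀.space n F c p, X₁.qnorm d q f ≤ C * X₀.qnorm c p f := by
  obtain ⟨C, hC, h⟩ : FractionalData.Controls (n := n) (F := F) (X₀.qnorm c p) (X₁.qnorm d q) := by
    cases p with
    | finite r s hr => exact FractionalData.controls_of_embeds_finite hn X₀ X₁ c d hpq hne
    | infinite s α hα => exact FractionalData.controls_of_embeds_infinite hn X₀ X₁ c d hpq hne
  lift C to ℝ≥0 using hC
  exact ⟨fun f hf => (h f).trans_lt (ENNReal.mul_lt_top ENNReal.coe_lt_top hf), C, fun f _ => h f⟩
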